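/- **Theorem (Local magnetization).** Let $s\ge 1$ be an integer ($s=1$: colourless chain, $s\ge2$: colourful chain) and put $\sigma=\frac{\sqrt s}{2\sqrt s+1}$. Consider a chain of $n$ spins, each with orthonormal basis states $|{-s}\rangle,\dots,|s\rangle$, where $|0\rangle$ is read as a flat step, $|k\rangle$ ($1\le k\le s$) as an up step of colour $k$ and $|{-k}\rangle$ as a down step of colour $k$, so that product basis states are walks of $n$ steps starting at height $0$. An $s$-coloured Motzkin walk is such a walk that ends at height $0$, never goes below height $0$, and in which every up step has the same colour as its matching down step (the first later step that returns to the height from which the up step started). Let $|\psi_{\mathrm{GS}}\rangle = M_n^{-1/2}\sum_w |w\rangle$ be the equal superposition of all $M_n$ $s$-coloured Motzkin walks of length $n$, let $S^z_b$ be the operator acting at site $b\in\{1,\dots,n\}$ by $S^z|k\rangle=k|k\rangle$ and trivially at the other sites, and write $\langle S^z_b\rangle=\langle\psi_{\mathrm{GS}}|S^z_b|\psi_{\mathrm{GS}}\rangle$. Then $$\langle S^z_b\rangle\;\approx\; F_n(b):=(s+1)\sqrt{\frac{\sigma}{\pi}}\;\frac{1-\frac{2b}{n}}{\sqrt{b\,(1-b/n)}}$$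 for sites $b$ far from both ends of the chain, in the following sense. 1. There is a constant $C>0$ depending only on $s$ such that $|\langle S^z_b\rangle-F_n(b)|\le \dfrac{C}{b(1-b/n)}$ for all $1\le b<n$. 2. In the bulk the error is $O(n^{-1})$: for every $\delta>0$ there is a constant $C>0$ depending only on $s$ and $\delta$ such that $|\langle S^z_b\rangle-F_n(b)|\le C/n$ whenever $1\le b<n$ and $\delta n\le b\le(1-\delta)n$. 3. If $b_k\to\infty$ and $n_k-b_k\to\infty$ as $k\to\infty$, where $1\le b_k<n_k$, and $|1-2b_k/n_k|$ is bounded away from $0$, then the ratio of $\langle S^z_{b_k}\rangle$ (in the chain of length $n_k$) to $F_{n_k}(b_k)$ tends to $1$. -/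

import Mathlib

open Filter

/-- The basis labels `-s, …, s` of one spin. The label `0` is a flat step, `k > 0` is an up step
of colour `k`, and `-k < 0` is a down step of colour `k`. -/
abbrev SpinLabel (s : ℕ) : Type := ↥(Finset.Icc (-(s : ℤ)) (s : ℤ))

/-- A walk of `n` coloured steps, i.e. a product basis state of the chain of `n` spins. -/
abbrev SpinWalk (s n : ℕ) : Type := Fin n → SpinLabel s

/-- The height (number of up steps minus number of down steps) after the first `x` steps. -/
def SpinWalk.height {s n : ℕ} (w : SpinWalk s n) (x : ℕ) : ℤ :=
  ∑ i : Fin n, if (i : ℕ) < x then ((w i : ℤ)).sign else 0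

/-- `s`-coloured Motzkin walks: the walk ends at height `0`, never goes below the axis, and every
up step `i` has the same colour as the step `j` that matches it, namely the first later step that
brings the walk back to the height from which step `i` started. -/
def SpinWalk.IsMotzkin {s n : ℕ} (w : SpinWalk s n) : Prop :=
  w.height n = 0 ∧
  (∀ x : ℕ, x ≤ n → 0 ≤ w.height x) ∧
  (∀ i j : Fin n, i < j → 0 < (w i : ℤ) →
    w.height ((j : ℕ) + 1) = w.height i →
    (∀ x : ℕ, (i : ℕ) < x → x ≤ (j : ℕ) → w.height i < w.height x) →
    (w j : ℤ) = -(w i : ℤ))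

/-- The Hilbert space `(ℂ^{2s+1})^{⊗ n}` of the chain, in coordinates for the product basis. -/
abbrev ChainSpace (s n : ℕ) : Type := EuclideanSpace ℂ (SpinWalk s n)

open Classical in
/-- The number `M_n` of `s`-coloured Motzkin walks of length `n`. -/
noncomputable def motzkinCount (s n : ℕ) : ℕ :=
  (Finset.univ.filter fun w : SpinWalk s n => w.IsMotzkin).card

open Classical in
/-- The Motzkin state: the normalized equal superposition of all `s`-coloured Motzkin walks. -/
noncomputable def motzkinState (s n : ℕ) : ChainSpace s n :=
  ((1 / Real.sqrt (motzkinCount s n : ℝ) : ℝ) : ℂ) •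
    ∑ w ∈ Finset.univ.filter (fun w : SpinWalk s n => w.IsMotzkin), EuclideanSpace.single w (1 : ℂ)

/-- The one-site operator `S^z`, diagonal with `S^z |k⟩ = k |k⟩`. -/
def spinZ (s : ℕ) : Matrix (SpinLabel s) (SpinLabel s) ℂ :=
  Matrix.diagonal fun k => ((k : ℤ) : ℂ)

/-- The operator `1 ⊗ ⋯ ⊗ A ⊗ ⋯ ⊗ 1` that acts as `A` at site `i` and trivially elsewhere. -/
def onSite {s n : ℕ} (i : Fin n) (A : Matrix (SpinLabel s) (SpinLabel s) ℂ) :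
    Matrix (SpinWalk s n) (SpinWalk s n) ℂ :=
  Matrix.of fun w w' =>
    A (w i) (w' i) * ∏ j ∈ Finset.univ.erase i, if w j = w' j then 1 else 0

/-- The expectation value `⟨ψ, O ψ⟩` of an operator `O` in the Motzkin state `ψ`. -/
noncomputable def motzkinExpectation {s n : ℕ} (O : Matrix (SpinWalk s n) (SpinWalk s n) ℂ) : ℂ :=
  inner ℂ (motzkinState s n) (Matrix.toEuclideanLin O (motzkinState s n))

/-- The local magnetization `⟨S^z⟩` at the site with (zero-based) index `i`. -/
noncomputable def localMagnetization (s n : ℕ) (i : Fin n) : ℂ :=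
  motzkinExpectation (onSite i (spinZ s))

/-- `σ = √s / (2√s + 1)`. -/
noncomputable def motzkinSigma (s : ℕ) : ℝ :=
  Real.sqrt s / (2 * Real.sqrt s + 1)

/-- `(s + 1) √(σ/π) (1 - 2b/n) / √(b(1 - b/n))`. -/
noncomputable def magnetizationProfile (s n b : ℕ) : ℝ :=
  ((s : ℝ) + 1) * Real.sqrt (motzkinSigma s / Real.pi) *
    ((1 - 2 * (b : ℝ) / n) / Real.sqrt ((b : ℝ) * (1 - (b : ℝ) / n)))

/-! `S^z` is diagonal, so the magnetization is the average label at a site over coloured Motzkin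
walks. The up steps of a path can be coloured freely and determine the down steps
(`card_colourings`). Reversing the order of the colours then shows that the average label is
`(s+1)/2` times the mean of the step sign over paths weighted by `s ^ ups` (`sum_label_eq`).

The mean step is hard to estimate directly, but its discrete derivative along the chain is explicit.
The signed and unsigned transfer operators commute except at height `0`, so moving the marked step
by one site changes the moment by `-2s` times a product of two path weights (`stepMoment_succ`).
Diagonalizing the transfer operator turns a path weight into an integral, and Watson's lemma gives
`M_n = c (2√s+1)^n n^(-3/2) (1 + O(1/n))` (`exists_abs_pathWeight_sub_le`).

With `β = b(1 - b/n)`, the increments of the mean step are therefore `-(κ/2) β^(-3/2)` up to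
`O(β^(-5/2))`. The derivative of `(1 - 2x/n)/√β` is exactly `-(1/2) β^(-3/2)`, so the difference
between the mean step and `κ` times this profile has summable increments `O(β^(-2))`. Reflection
antisymmetry makes the difference `O(1/n)` at the middle of the chain, and summing outwards gives
`O(1/β)` everywhere (`exists_abs_stepError_le`). The three claims follow from this bound. -/

/-! ### Reduction of the quantum expectation to an average over walks. -/

theorem onSite_spinZ {s n : ℕ} (i : Fin n) :
    onSite i (spinZ s) = Matrix.diagonal fun w : SpinWalk s n => ((w i : ℤ) : ℂ) := by
  ext w w'
  by_cases h : w = w'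
  · subst h
    simp [onSite, spinZ]
  · rw [Matrix.diagonal_apply_ne _ h]
    obtain ⟨j, hj⟩ := Function.ne_iff.mp h
    by_cases hji : j = i
    · subst hji
      simp [onSite, spinZ, Matrix.diagonal_apply_ne _ hj]
    · simp only [onSite, Matrix.of_apply]
      rw [Finset.prod_eq_zero (i := j) (by simp [hji]) (by simp [hj]), mul_zero]

open Classical in
theorem motzkinState_apply {s n : ℕ} (w : SpinWalk s n) :
    motzkinState s n w
      = if w.IsMotzkin then ((1 / Real.sqrt (motzkinCount s n : ℝ) : ℝ) : ℂ) else 0 := by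
  simp only [motzkinState, PiLp.smul_apply, WithLp.ofLp_sum, Finset.sum_apply, smul_eq_mul]
  simp [Finset.sum_ite_eq]

open Classical in
theorem localMagnetization_eq {s n : ℕ} (i : Fin n) :
    localMagnetization s n i
      = (((∑ w : SpinWalk s n with w.IsMotzkin, ((w i : ℤ) : ℝ)) / motzkinCount s n : ℝ) : ℂ) := by
  have key : ∀ w : SpinWalk s n,
      inner ℂ (motzkinState s n w)
        ((Matrix.toEuclideanLin (onSite i (spinZ s)) (motzkinState s n)) w)
      = if w.IsMotzkin then ((((w i : ℤ) : ℝ) / motzkinCount s n : ℝ) : ℂ) else 0 := by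
    intro w
    rw [onSite_spinZ, Matrix.toLpLin_apply]
    simp only [Matrix.mulVec_diagonal, motzkinState_apply]
    split_ifs with h
    · have h2 : ((Real.sqrt (motzkinCount s n) : ℝ) : ℂ) * ((Real.sqrt (motzkinCount s n) : ℝ) : ℂ)
          = motzkinCount s n := by
        rw [← Complex.ofReal_mul, Real.mul_self_sqrt (Nat.cast_nonneg _)]; simp
      simp only [RCLike.inner_apply, Complex.conj_ofReal]
      push_cast
      rw [← h2]
      ring
    · simp
  rw [localMagnetization, motzkinExpectation, PiLp.inner_apply, Finset.sum_congr rfl fun w _ => key w,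
    ← Finset.sum_filter, Finset.sum_div]
  push_cast
  rfl

/-! ### Sign patterns -/

/-- The height, relative to the start, after the first `x` steps of a sign pattern. -/
def patternHeight {n : ℕ} (v : Fin n → SignType) (x : ℕ) : ℤ :=
  ∑ i : Fin n, if (i : ℕ) < x then (v i : ℤ) else 0

/-- A sign pattern that, started at height `h`, stays nonnegative and ends at height `0`. -/
def IsPath {n : ℕ} (h : ℤ) (v : Fin n → SignType) : Prop :=
  h + patternHeight v n = 0 ∧ ∀ x ≤ n, 0 ≤ h + patternHeight v x

/-- The pattern of signs of a coloured walk. -/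
noncomputable def SpinWalk.pattern {s n : ℕ} (w : SpinWalk s n) : Fin n → SignType :=
  fun i => SignType.sign (w i : ℤ)

theorem SpinWalk.height_eq {s n : ℕ} (w : SpinWalk s n) (x : ℕ) :
    w.height x = patternHeight w.pattern x := by
  simp [SpinWalk.height, patternHeight, SpinWalk.pattern, Int.sign_eq_sign]

theorem patternHeight_zero {n : ℕ} (v : Fin n → SignType) : patternHeight v 0 = 0 := by
  simp [patternHeight]

theorem patternHeight_succ {n : ℕ} (v : Fin n → SignType) (i : Fin n) :
    patternHeight v (i + 1) = patternHeight v i + v i := by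
  have h : (v i : ℤ) = ∑ j : Fin n, if j = i then (v j : ℤ) else 0 := by simp
  rw [patternHeight, patternHeight, h, ← Finset.sum_add_distrib]
  refine Finset.sum_congr rfl fun j _ => ?_
  by_cases hji : j = i
  · subst hji; simp
  · have : (j : ℕ) ≠ i := fun h => hji (Fin.ext h)
    have h2 : (j : ℕ) < i + 1 ↔ (j : ℕ) < i := by omega
    simp [hji, h2]

theorem SpinWalk.IsMotzkin.isPath {s n : ℕ} {w : SpinWalk s n} (hw : w.IsMotzkin) :
    IsPath 0 w.pattern := by
  refine ⟨?_, fun x hx => ?_⟩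
  · simpa [SpinWalk.height_eq] using hw.1
  · simpa [SpinWalk.height_eq] using hw.2.1 x hx

/-- Step `j` of the sign pattern `v` is the match of step `i`. -/
def IsMatch {n : ℕ} (v : Fin n → SignType) (i j : Fin n) : Prop :=
  i < j ∧ patternHeight v (j + 1) = patternHeight v i ∧
    ∀ x : ℕ, (i : ℕ) < x → x ≤ j → patternHeight v i < patternHeight v x

theorem IsMatch.left_eq_one {n : ℕ} {v : Fin n → SignType} {i j : Fin n} (h : IsMatch v i j) :
    v i = 1 := by
  have h1 := h.2.2 (i + 1) (by omega) (by have := h.1; omega)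
  rw [patternHeight_succ] at h1
  rcases hv : v i with _ | _ | _ <;> simp_all

theorem IsMatch.right_eq_neg_one {n : ℕ} {v : Fin n → SignType} {i j : Fin n}
    (h : IsMatch v i j) : v j = -1 := by
  have h1 := h.2.2 j h.1 le_rfl
  have h2 := h.2.1
  rw [patternHeight_succ] at h2
  rcases hv : v j with _ | _ | _
  · rw [hv] at h2; simp at h2; omega
  · rfl
  · rw [hv] at h2; simp at h2; omega

theorem IsMatch.left_unique {n : ℕ} {v : Fin n → SignType} {i i' j : Fin n}
    (h : IsMatch v i j) (h' : IsMatch v i' j) : i = i' := by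
  have e := h.2.1.symm.trans h'.2.1
  rcases lt_trichotomy i i' with hlt | heq | hlt
  · have := h.2.2 i' hlt h'.1.le
    omega
  · exact heq
  · have := h'.2.2 i hlt h.1.le
    omega

/-- The match is the last index up to `j` whose height is at most the height after step `j`; index
`0` qualifies because the path is nonnegative. Beyond it the path is strictly higher, and a step
rises by at most one, so the two heights are equal. -/
theorem IsPath.exists_isMatch {n : ℕ} {v : Fin n → SignType} (hv : IsPath 0 v) {j : Fin n}
    (hj : v j = -1) : ∃ i, IsMatch v i j := by
  have hjs := patternHeight_succ v j
  rw [hj] at hjs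
  have hpos := hv.2 (j + 1) j.2
  classical
  let S := (Finset.univ.filter fun i : Fin n => i ≤ j ∧ patternHeight v i ≤ patternHeight v (j + 1))
  have hS : S.Nonempty := by
    refine ⟨⟨0, by have := j.2; omega⟩, ?_⟩
    simp only [S, Finset.mem_filter, Finset.mem_univ, true_and]
    refine ⟨Nat.zero_le _, ?_⟩
    rw [patternHeight_zero]; omega
  obtain ⟨i, hi, hmax⟩ := S.exists_max_image id hS
  simp only [S, Finset.mem_filter, Finset.mem_univ, true_and, id] at hi hmax
  have hij : i < j := by
    refine lt_of_le_of_ne hi.1 fun h => ?_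
    subst h
    have := hi.2
    simp at hjs
    omega
  have habove : ∀ x : ℕ, (i : ℕ) < x → x ≤ j → patternHeight v (j + 1) < patternHeight v x := by
    intro x hx hxj
    by_contra hcon
    have := hmax ⟨x, by have := j.2; omega⟩ ⟨hxj, not_lt.mp hcon⟩
    have : x ≤ (i : ℕ) := this
    omega
  have hi1 := habove (i + 1) (by omega) (by omega)
  rw [patternHeight_succ v i] at hi1
  have hvi : (v i : ℤ) ≤ 1 := by rcases v i with _ | _ | _ <;> simp
  have heq : patternHeight v (j + 1) = patternHeight v i := by have := hi.2; omega
  exact ⟨i, hij, heq, fun x hx hxj => heq ▸ habove x hx hxj⟩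

/-- Separates the shape of a walk from its colours. The condition that step `i` goes up can be
dropped, since a match forces it. -/
theorem SpinWalk.isMotzkin_iff {s n : ℕ} (w : SpinWalk s n) :
    w.IsMotzkin ↔ IsPath 0 w.pattern ∧
      ∀ i j, IsMatch w.pattern i j → (w j : ℤ) = -(w i : ℤ) := by
  constructor
  · intro h
    refine ⟨h.isPath, fun i j hm => h.2.2 i j hm.1 ?_ ?_ ?_⟩
    · exact sign_eq_one_iff.mp hm.left_eq_one
    · simpa [SpinWalk.height_eq] using hm.2.1
    · simpa [SpinWalk.height_eq] using hm.2.2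
  · rintro ⟨h1, h2⟩
    refine ⟨by simpa [SpinWalk.height_eq] using h1.1,
      fun x hx => by simpa [SpinWalk.height_eq] using h1.2 x hx, fun i j hij _ he hx => ?_⟩
    exact h2 i j ⟨hij, by simpa [SpinWalk.height_eq] using he,
      by simpa [SpinWalk.height_eq] using hx⟩

/-! ### Counting colourings -/

/-- The labels of up steps. -/
abbrev UpLabel (s : ℕ) : Type := {z : SpinLabel s // 0 < (z : ℤ)}

theorem card_upLabel (s : ℕ) : Fintype.card (UpLabel s) = s := by
  have e : UpLabel s ≃ Finset.Icc (1 : ℤ) s :=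
    { toFun := fun z => ⟨z.1.1, by
        have := z.2; have h := Finset.mem_Icc.mp z.1.2; exact Finset.mem_Icc.mpr ⟨this, h.2⟩⟩
      invFun := fun z => ⟨⟨z.1, by
        have h := Finset.mem_Icc.mp z.2; exact Finset.mem_Icc.mpr ⟨by omega, h.2⟩⟩, by
        have h := Finset.mem_Icc.mp z.2; exact h.1⟩
      left_inv := fun z => rfl
      right_inv := fun z => rfl }
  rw [Fintype.card_congr e]
  simp

/-- The weight `s ^ (number of up steps)` of a sign pattern. -/
def upWeight (s : ℕ) {n : ℕ} (v : Fin n → SignType) : ℕ :=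
  ∏ i, if v i = 1 then s else 1

theorem SpinLabel.neg_mem {s : ℕ} (z : SpinLabel s) :
    -(z : ℤ) ∈ Finset.Icc (-(s : ℤ)) (s : ℤ) := by
  have := Finset.mem_Icc.mp z.2
  exact Finset.mem_Icc.mpr ⟨by omega, by omega⟩

open Classical in
-- Restricting a walk to its up steps is a bijection onto free choices of colours: every down step
-- has exactly one matching up step, which dictates its label.
theorem card_colourings (s : ℕ) {n : ℕ} {v : Fin n → SignType} (hv : IsPath 0 v) :
    (Finset.univ.filter fun w : SpinWalk s n => w.IsMotzkin ∧ w.pattern = v).card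
      = upWeight s v := by
  have hcard : upWeight s v = Fintype.card ({i // v i = 1} → UpLabel s) := by
    rw [Fintype.card_fun, card_upLabel, upWeight, Finset.prod_ite, Finset.prod_const,
      Finset.prod_const_one, mul_one, Fintype.card_subtype]
  rw [hcard, ← Finset.card_univ]
  refine Finset.card_bij
    (fun w hw i => ⟨w i.1, by
      have h := (Finset.mem_filter.mp hw).2.2
      exact sign_eq_one_iff.mp ((congrFun h i.1).trans i.2)⟩) (fun _ _ => Finset.mem_univ _) ?_ ?_
  · intro w hw w' hw' he
    obtain ⟨hm, hp⟩ := (Finset.mem_filter.mp hw).2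
    obtain ⟨hm', hp'⟩ := (Finset.mem_filter.mp hw').2
    have hup : ∀ i, v i = 1 → w i = w' i := fun i hi =>
      congrArg Subtype.val (congrFun he ⟨i, hi⟩)
    funext j
    rcases hj : v j with _ | _ | _
    · have h1 : SignType.sign (w j : ℤ) = 0 := by
        have := congrFun hp j; rw [hj] at this; exact this
      have h2 : SignType.sign (w' j : ℤ) = 0 := by
        have := congrFun hp' j; rw [hj] at this; exact this
      rw [sign_eq_zero_iff] at h1 h2
      exact Subtype.ext (h1.trans h2.symm)
    · obtain ⟨i, hi⟩ := hv.exists_isMatch (j := j) hj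
      have h1 := ((SpinWalk.isMotzkin_iff w).mp hm).2 i j (by rw [hp]; exact hi)
      have h2 := ((SpinWalk.isMotzkin_iff w').mp hm').2 i j (by rw [hp']; exact hi)
      rw [hup i hi.left_eq_one] at h1
      exact Subtype.ext (h1.trans h2.symm)
    · exact hup j hj
  · intro c _
    let w : SpinWalk s n := fun j =>
      if hj : v j = 1 then (c ⟨j, hj⟩).1
      else if hj' : v j = -1 then
        ⟨-((c ⟨(hv.exists_isMatch hj').choose,
          (hv.exists_isMatch hj').choose_spec.left_eq_one⟩).1 : ℤ), SpinLabel.neg_mem _⟩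
      else ⟨0, Finset.mem_Icc.mpr ⟨by omega, by omega⟩⟩
    have hp : w.pattern = v := by
      funext j
      rcases hj : v j with _ | _ | _
      · have h1 : v j ≠ 1 := by rw [hj]; decide
        have h2 : v j ≠ -1 := by rw [hj]; decide
        simp only [SpinWalk.pattern, w, dif_neg h1, dif_neg h2]
        exact sign_zero
      · have h1 : v j ≠ 1 := by rw [hj]; decide
        have h2 : v j = -1 := hj
        simp only [SpinWalk.pattern, w, dif_neg h1, dif_pos h2]
        refine sign_eq_neg_one_iff.mpr (neg_lt_zero.mpr ?_)
        exact (c _).2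
      · have h1 : v j = 1 := hj
        simp only [SpinWalk.pattern, w, dif_pos h1]
        exact sign_eq_one_iff.mpr (c _).2
    refine ⟨w, Finset.mem_filter.mpr ⟨Finset.mem_univ _, ?_, hp⟩, ?_⟩
    · rw [SpinWalk.isMotzkin_iff, hp]
      refine ⟨hv, fun i j hm => ?_⟩
      have hi := hm.left_eq_one
      have hj := hm.right_eq_neg_one
      have hj1 : v j ≠ 1 := by rw [hj]; decide
      -- The match chosen when defining `w` is the given one, because matches are unique.
      have hu : (hv.exists_isMatch hj).choose = i :=
        (hv.exists_isMatch hj).choose_spec.left_unique hm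
      simp only [w, dif_pos hi, dif_neg hj1, dif_pos hj, hu]
    · funext i
      apply Subtype.ext
      simp only [w, dif_pos i.2]

open Classical in
theorem sum_isMotzkin_pattern (s : ℕ) {n : ℕ} (g : (Fin n → SignType) → ℝ) :
    ∑ w : SpinWalk s n with w.IsMotzkin, g w.pattern
      = ∑ v : Fin n → SignType with IsPath 0 v, (upWeight s v : ℝ) * g v := by
  rw [← Finset.sum_fiberwise_of_maps_to (t := Finset.univ.filter fun v => IsPath 0 v)
    (g := fun w : SpinWalk s n => w.pattern)
    (fun w hw => by simpa using (Finset.mem_filter.mp hw).2.isPath)]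
  refine Finset.sum_congr rfl fun v hv => ?_
  rw [← card_colourings s (Finset.mem_filter.mp hv).2, ← nsmul_eq_mul, ← Finset.sum_const,
    Finset.filter_filter]
  refine Finset.sum_congr rfl fun w hw => ?_
  rw [(Finset.mem_filter.mp hw).2.2]

/-! ### Averaging over colours -/

/-- Reverses the order of the colours `1, …, s`, keeping the direction of the step. -/
def flipColour {s : ℕ} (z : SpinLabel s) : SpinLabel s :=
  ⟨((z : ℤ).sign) * (s + 1) - z, by
    have := Finset.mem_Icc.mp z.2
    rw [Finset.mem_Icc]
    rcases lt_trichotomy (z : ℤ) 0 with h | h | h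
    · rw [Int.sign_eq_neg_one_of_neg h]; omega
    · rw [h]; simp
    · rw [Int.sign_eq_one_of_pos h]; omega⟩

theorem sign_flipColour {s : ℕ} (z : SpinLabel s) :
    SignType.sign (flipColour z : ℤ) = SignType.sign (z : ℤ) := by
  have := Finset.mem_Icc.mp z.2
  simp only [flipColour]
  rcases lt_trichotomy (z : ℤ) 0 with h | h | h
  · rw [Int.sign_eq_neg_one_of_neg h, sign_neg h]; exact sign_neg (by omega)
  · rw [h]; simp
  · rw [Int.sign_eq_one_of_pos h, sign_pos h]; exact sign_pos (by omega)

theorem flipColour_flipColour {s : ℕ} (z : SpinLabel s) : flipColour (flipColour z) = z := by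
  apply Subtype.ext
  have h : (flipColour z : ℤ).sign = (z : ℤ).sign := by
    rw [Int.sign_eq_sign, Int.sign_eq_sign, sign_flipColour]
  change (flipColour z : ℤ).sign * (s + 1) - ((z : ℤ).sign * (s + 1) - z) = z
  rw [h]; ring

/-- Reverses the order of the colours along a walk. -/
def SpinWalk.flip {s n : ℕ} (w : SpinWalk s n) : SpinWalk s n := fun i => flipColour (w i)

theorem SpinWalk.pattern_flip {s n : ℕ} (w : SpinWalk s n) : w.flip.pattern = w.pattern :=
  funext fun i => sign_flipColour (w i)

theorem SpinWalk.flip_flip {s n : ℕ} (w : SpinWalk s n) : w.flip.flip = w :=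
  funext fun i => flipColour_flipColour (w i)

/-- `flipColour` is odd and keeps signs, so matched steps still carry opposite labels. -/
theorem SpinWalk.IsMotzkin.flip {s n : ℕ} {w : SpinWalk s n} (hw : w.IsMotzkin) :
    w.flip.IsMotzkin := by
  rw [SpinWalk.isMotzkin_iff] at hw ⊢
  rw [SpinWalk.pattern_flip]
  refine ⟨hw.1, fun i j hm => ?_⟩
  have := hw.2 i j hm
  change (w j : ℤ).sign * (s + 1) - w j = -((w i : ℤ).sign * (s + 1) - w i)
  rw [this, Int.sign_neg]; ring

open Classical in
-- The flip is an involution of the Motzkin walks, and a label and its flip add up to `s + 1` times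
-- the sign of the step.
theorem sum_label_eq {s n : ℕ} (i : Fin n) :
    ∑ w : SpinWalk s n with w.IsMotzkin, ((w i : ℤ) : ℝ)
      = ((s : ℝ) + 1) / 2 *
        ∑ v : Fin n → SignType with IsPath 0 v, (upWeight s v : ℝ) * ((v i : ℤ) : ℝ) := by
  have h1 : ∑ w : SpinWalk s n with w.IsMotzkin, ((w i : ℤ) : ℝ)
      = ∑ w : SpinWalk s n with w.IsMotzkin, ((w.flip i : ℤ) : ℝ) := by
    refine Finset.sum_bij' (fun w _ => w.flip) (fun w _ => w.flip) ?_ ?_ ?_ ?_ ?_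
    · intro w hw; simpa using (Finset.mem_filter.mp hw).2.flip
    · intro w hw; simpa using (Finset.mem_filter.mp hw).2.flip
    · intro w _; exact w.flip_flip
    · intro w _; exact w.flip_flip
    · intro w _; rw [w.flip_flip]
  rw [← sum_isMotzkin_pattern s (fun v => ((v i : ℤ) : ℝ)), Finset.mul_sum]
  have h2 : ∑ w : SpinWalk s n with w.IsMotzkin, ((w i : ℤ) : ℝ)
      = 1 / 2 * ∑ w : SpinWalk s n with w.IsMotzkin, (((w i : ℤ) : ℝ) + ((w.flip i : ℤ) : ℝ)) := by
    rw [Finset.sum_add_distrib, ← h1]; ring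
  rw [h2, Finset.mul_sum]
  refine Finset.sum_congr rfl fun w _ => ?_
  have : ((w.flip i : ℤ)) = (SignType.sign (w i : ℤ) : ℤ) * (s + 1) - w i := by
    rw [← Int.sign_eq_sign]; rfl
  rw [this, SpinWalk.pattern]
  push_cast
  ring

/-! ### The transfer operator -/

/-- Weighted sum over one step from height `h`: up steps have weight `s`. -/
def transfer (s : ℝ) (f : ℕ → ℝ) : ℕ → ℝ
  | 0 => f 0 + s * f 1
  | h + 1 => f (h + 1) + s * f (h + 2) + f h

/-- The sum over one step from height `h`, signed by the direction of the step. -/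
def signedTransfer (s : ℝ) (f : ℕ → ℝ) : ℕ → ℝ
  | 0 => s * f 1
  | h + 1 => s * f (h + 2) - f h

/-- The indicator function of height `0`. -/
def groundIndicator : ℕ → ℝ
  | 0 => 1
  | _ + 1 => 0

/-- The weighted number of paths of length `n` from height `h` to height `0`. -/
def pathWeight (s : ℝ) (n : ℕ) : ℕ → ℝ := (transfer s)^[n] groundIndicator

/-- The sum of step number `i + 1` over paths of length `i + 1 + j` from height `h` to `0`. -/
def stepMoment (s : ℝ) (i j : ℕ) : ℕ → ℝ :=
  (transfer s)^[i] (signedTransfer s (pathWeight s j))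

theorem isPath_cons {n : ℕ} (h : ℤ) (a : SignType) (v : Fin n → SignType) :
    IsPath h (Fin.cons a v : Fin (n + 1) → SignType) ↔ 0 ≤ h ∧ IsPath (h + a) v := by
  have hs : ∀ x : ℕ, patternHeight (Fin.cons a v : Fin (n + 1) → SignType) (x + 1)
      = a + patternHeight v x := by
    intro x
    simp [patternHeight, Fin.sum_univ_succ]
  constructor
  · rintro ⟨h1, h2⟩
    refine ⟨by simpa [patternHeight_zero] using h2 0 (Nat.zero_le _), ?_, fun x hx => ?_⟩
    · rw [hs] at h1; omega
    · have := h2 (x + 1) (by omega)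
      rw [hs] at this; omega
  · rintro ⟨h0, h1, h2⟩
    refine ⟨by rw [hs]; omega, fun x hx => ?_⟩
    rcases x with _ | x
    · simpa [patternHeight_zero] using h0
    · have := h2 x (by omega)
      rw [hs]; omega

theorem IsPath.nonneg {n : ℕ} {h : ℤ} {v : Fin n → SignType} (hv : IsPath h v) : 0 ≤ h := by
  simpa [patternHeight_zero] using hv.2 0 (Nat.zero_le _)

theorem upWeight_cons (s : ℕ) {n : ℕ} (a : SignType) (v : Fin n → SignType) :
    upWeight s (Fin.cons a v : Fin (n + 1) → SignType)
      = (if a = 1 then s else 1) * upWeight s v := by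
  simp [upWeight, Fin.prod_univ_succ]

open Classical in
/-- The weighted sum of `g` over paths from height `h` to height `0`. -/
noncomputable def pathSum (s : ℕ) {n : ℕ} (g : (Fin n → SignType) → ℝ) (h : ℤ) : ℝ :=
  ∑ v : Fin n → SignType with IsPath h v, (upWeight s v : ℝ) * g v

theorem pathSum_of_neg (s : ℕ) {n : ℕ} (g : (Fin n → SignType) → ℝ) {h : ℤ} (hh : h < 0) :
    pathSum s g h = 0 := by
  classical
  refine Finset.sum_eq_zero fun v hv => ?_
  have := (Finset.mem_filter.mp hv).2.nonneg
  omega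

/-- Conditioning on the first step, this is the recursion behind `transfer`. Heights are integers
here; the down term at height `0` vanishes by `pathSum_of_neg`. -/
theorem pathSum_succ (s : ℕ) {n : ℕ} (g : (Fin (n + 1) → SignType) → ℝ) {h : ℤ} (hh : 0 ≤ h) :
    pathSum s g h = pathSum s (fun v => g (Fin.cons 0 v)) h
      + s * pathSum s (fun v => g (Fin.cons 1 v)) (h + 1)
      + pathSum s (fun v => g (Fin.cons (-1) v)) (h - 1) := by
  classical
  have huniv : (Finset.univ : Finset SignType) = {0, 1, -1} := by decide
  simp only [pathSum, Finset.sum_filter]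
  rw [← (Fin.consEquiv fun _ => SignType).sum_comp, Fintype.sum_prod_type, huniv,
    Finset.sum_insert (by decide), Finset.sum_insert (by decide), Finset.sum_singleton,
    ← add_assoc, Finset.mul_sum]
  have he : ∀ (a : SignType) (v : Fin n → SignType),
      (Fin.consEquiv fun _ : Fin (n + 1) => SignType) (a, v) = Fin.cons a v := fun _ _ => rfl
  simp only [he, isPath_cons, upWeight_cons, hh, true_and]
  congr 1
  · congr 1
    · refine Finset.sum_congr rfl fun v _ => ?_
      simp
    · refine Finset.sum_congr rfl fun v _ => ?_
      simp [mul_assoc]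
  · refine Finset.sum_congr rfl fun v _ => ?_
    have : ((-1 : SignType) = 1) ↔ False := by decide
    simp [this, sub_eq_add_neg]

theorem pathSum_one (s n : ℕ) (h : ℕ) :
    pathSum s (fun _ : Fin n → SignType => 1) h = pathWeight s n h := by
  induction n generalizing h with
  | zero =>
    classical
    have hp : ∀ v : Fin 0 → SignType, IsPath (h : ℤ) v ↔ h = 0 := by
      intro v
      simp only [IsPath, patternHeight]
      constructor
      · rintro ⟨h1, -⟩; simpa using h1
      · rintro rfl; simp
    simp only [pathSum, hp, upWeight]
    rcases h with _ | h <;> simp [pathWeight, groundIndicator]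
  | succ n ih =>
    rw [pathSum_succ s _ (by positivity), pathWeight, Function.iterate_succ_apply',
      ← pathWeight]
    rcases h with _ | h
    · have hm : ((0 : ℕ) : ℤ) - 1 < 0 := by simp
      rw [pathSum_of_neg s _ hm]
      have h1 := ih 1
      have h0 := ih 0
      simp only [Nat.cast_zero, Nat.cast_one, zero_add] at h0 h1 ⊢
      rw [h0, h1, transfer, add_zero]
    · have h1 := ih (h + 2)
      have h0 := ih (h + 1)
      have h2 := ih h
      have e1 : ((h + 1 : ℕ) : ℤ) + 1 = (h + 2 : ℕ) := by push_cast; ring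
      have e2 : ((h + 1 : ℕ) : ℤ) - 1 = (h : ℕ) := by push_cast; ring
      rw [e1, e2, h0, h1, h2, transfer]

theorem pathSum_step (s i j : ℕ) (h : ℕ) :
    pathSum s (fun v : Fin (i + 1 + j) → SignType =>
      (((v ⟨i, by omega⟩ : SignType) : ℤ) : ℝ)) h = stepMoment s i j h := by
  -- A free length `n` keeps the induction on `i` clear of casts between `Fin` types.
  suffices H : ∀ n (hn : n = i + 1 + j) (h : ℕ),
      pathSum s (fun v : Fin n → SignType =>
        (((v ⟨i, by omega⟩ : SignType) : ℤ) : ℝ)) h = stepMoment s i j h from H _ rfl h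
  clear h
  induction i with
  | zero =>
    intro n hn h
    obtain rfl : n = j + 1 := by omega
    have e : (⟨0, by omega⟩ : Fin (j + 1)) = 0 := rfl
    have hz : ∀ h : ℤ, pathSum s (fun _ : Fin j → SignType => (0 : ℝ)) h = 0 := by
      intro h; simp [pathSum]
    have hneg : ∀ h : ℤ, pathSum s (fun _ : Fin j → SignType => (-1 : ℝ)) h
        = - pathSum s (fun _ : Fin j → SignType => (1 : ℝ)) h := by
      intro h; simp [pathSum]
    rw [pathSum_succ s _ (by positivity)]
    simp only [e, Fin.cons_zero, SignType.coe_zero, SignType.coe_one, SignType.coe_neg_one,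
      Int.cast_zero, Int.cast_one, Int.cast_neg, hz, hneg, stepMoment, Function.iterate_zero, id]
    rcases h with _ | h
    · have hm : ((0 : ℕ) : ℤ) - 1 < 0 := by simp
      rw [pathSum_of_neg s _ hm]
      have h1 := pathSum_one s j 1
      simp only [Nat.cast_zero, Nat.cast_one, zero_add] at h1 ⊢
      rw [h1, signedTransfer]; ring
    · have e1 : ((h + 1 : ℕ) : ℤ) + 1 = (h + 2 : ℕ) := by push_cast; ring
      have e2 : ((h + 1 : ℕ) : ℤ) - 1 = (h : ℕ) := by push_cast; ring
      rw [e1, e2, pathSum_one, pathSum_one, signedTransfer]; ring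
  | succ i ih =>
    intro n hn h
    obtain ⟨n, rfl⟩ : ∃ m, n = m + 1 := ⟨n - 1, by omega⟩
    have ih' := ih n (by omega)
    have e : (⟨i + 1, by omega⟩ : Fin (n + 1)) = Fin.succ ⟨i, by omega⟩ := rfl
    rw [pathSum_succ s _ (by positivity)]
    simp only [e, Fin.cons_succ]
    rw [stepMoment, Function.iterate_succ_apply', ← stepMoment]
    rcases h with _ | h
    · have hm : ((0 : ℕ) : ℤ) - 1 < 0 := by simp
      rw [pathSum_of_neg s _ hm]
      have h1 := ih' 1
      have h0 := ih' 0
      simp only [Nat.cast_zero, Nat.cast_one, zero_add] at h0 h1 ⊢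
      rw [h0, h1, transfer, add_zero]
    · have h1 := ih' (h + 2)
      have h0 := ih' (h + 1)
      have h2 := ih' h
      have e1 : ((h + 1 : ℕ) : ℤ) + 1 = (h + 2 : ℕ) := by push_cast; ring
      have e2 : ((h + 1 : ℕ) : ℤ) - 1 = (h : ℕ) := by push_cast; ring
      rw [e1, e2, h0, h1, h2, transfer]

theorem motzkinCount_eq (s n : ℕ) : (motzkinCount s n : ℝ) = pathWeight s n 0 := by
  classical
  have h := sum_isMotzkin_pattern s (n := n) (fun _ => 1)
  rw [← pathSum_one]
  simp only [Finset.sum_const, nsmul_eq_mul, mul_one] at h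
  simp only [motzkinCount, pathSum, Nat.cast_zero, mul_one]
  convert h

theorem localMagnetization_eq_stepMoment (s n i j : ℕ) (hn : n = i + 1 + j) :
    localMagnetization s n ⟨i, by omega⟩
      = ((((s : ℝ) + 1) / 2 * (stepMoment s i j 0 / pathWeight s n 0) : ℝ) : ℂ) := by
  classical
  subst hn
  rw [localMagnetization_eq, sum_label_eq, motzkinCount_eq, ← pathSum_step, pathSum, mul_div_assoc]
  norm_cast

/-! ### The commutator identity -/

theorem transfer_add (s : ℝ) (f g : ℕ → ℝ) :
    transfer s (f + g) = transfer s f + transfer s g := by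
  funext h
  rcases h with _ | h <;> simp [transfer] <;> ring

theorem transfer_smul (s c : ℝ) (f : ℕ → ℝ) : transfer s (c • f) = c • transfer s f := by
  funext h
  rcases h with _ | h <;> simp [transfer] <;> ring

theorem transfer_iterate_add (s : ℝ) (n : ℕ) (f g : ℕ → ℝ) :
    (transfer s)^[n] (f + g) = (transfer s)^[n] f + (transfer s)^[n] g := by
  induction n generalizing f g with
  | zero => rfl
  | succ n ih => simp only [Function.iterate_succ_apply, transfer_add, ih]

theorem transfer_iterate_smul (s c : ℝ) (n : ℕ) (f : ℕ → ℝ) :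
    (transfer s)^[n] (c • f) = c • (transfer s)^[n] f := by
  induction n generalizing f with
  | zero => rfl
  | succ n ih => simp only [Function.iterate_succ_apply, transfer_smul, ih]

/-- Away from the wall both operators are combinations of commuting shifts; only the missing down
step at height `0` contributes to the commutator. -/
theorem transfer_signedTransfer (s : ℝ) (f : ℕ → ℝ) :
    transfer s (signedTransfer s f)
      = signedTransfer s (transfer s f) + (-(2 * s * f 0)) • groundIndicator := by
  funext h
  rcases h with _ | _ | h <;>
    simp [transfer, signedTransfer, groundIndicator] <;> ring

/-- The commutator is concentrated at height `0`, so it splits the path there into two independent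
Motzkin paths of lengths `i` and `j`. -/
theorem stepMoment_succ (s : ℝ) (i j : ℕ) :
    stepMoment s (i + 1) j 0
      = stepMoment s i (j + 1) 0 - 2 * s * pathWeight s i 0 * pathWeight s j 0 := by
  rw [stepMoment, Function.iterate_succ_apply, transfer_signedTransfer, transfer_iterate_add,
    transfer_iterate_smul, stepMoment, pathWeight, pathWeight, pathWeight,
    Function.iterate_succ_apply' _ j]
  simp only [Pi.add_apply, Pi.smul_apply, smul_eq_mul]
  ring

theorem stepMoment_zero_left (s : ℝ) (j : ℕ) :
    stepMoment s 0 j 0 = pathWeight s (j + 1) 0 - pathWeight s j 0 := by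
  rw [pathWeight, Function.iterate_succ_apply', ← pathWeight]
  simp [stepMoment, signedTransfer, transfer]

theorem stepMoment_zero_right (s : ℝ) (i : ℕ) :
    stepMoment s i 0 0 = -(pathWeight s (i + 1) 0 - pathWeight s i 0) := by
  have h : transfer s groundIndicator
      = groundIndicator + (-1 : ℝ) • signedTransfer s groundIndicator := by
    funext h
    rcases h with _ | _ | h <;> simp [transfer, signedTransfer, groundIndicator]
  rw [stepMoment, pathWeight, pathWeight, pathWeight, Function.iterate_succ_apply, h,
    transfer_iterate_add, transfer_iterate_smul]
  simp

/-- Reversing paths exchanges up and down steps. Algebraically, the correction in `stepMoment_succ`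
is symmetric in `i` and `j`, so antisymmetry propagates from the end of the chain. -/
theorem stepMoment_antisymm (s : ℝ) (i j : ℕ) : stepMoment s i j 0 = -stepMoment s j i 0 := by
  induction i generalizing j with
  | zero => rw [stepMoment_zero_left, stepMoment_zero_right, neg_neg]
  | succ i ih =>
    rw [stepMoment_succ, ih, stepMoment_succ s j i]
    ring

/-! ### Integral representation of the path weights -/

theorem integral_cos_nat_mul_eq_zero {k : ℕ} (hk : k ≠ 0) :
    ∫ θ in (0 : ℝ)..Real.pi, Real.cos (k * θ) = 0 := by
  rw [intervalIntegral.integral_comp_mul_left (fun x => Real.cos x) (Nat.cast_ne_zero.mpr hk)]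
  simp

theorem integral_sin_mul_sin_succ (h : ℕ) :
    ∫ θ in (0 : ℝ)..Real.pi, Real.sin θ * Real.sin ((h + 1) * θ)
      = Real.pi / 2 * groundIndicator h := by
  rcases h with _ | h
  · have : ∀ θ : ℝ, Real.sin θ * Real.sin (((0 : ℕ) + 1) * θ) = Real.sin θ ^ 2 := by
      intro θ; simp [sq]
    simp only [this, integral_sin_sq, groundIndicator]
    simp
  · have : ∀ θ : ℝ, Real.sin θ * Real.sin (((h + 1 : ℕ) + 1) * θ)
        = 1 / 2 * (Real.cos ((h + 1 : ℕ) * θ) - Real.cos ((h + 3 : ℕ) * θ)) := by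
      intro θ
      have h1 : ((h + 1 : ℕ) : ℝ) * θ = ((h + 1 : ℕ) + 1) * θ - θ := by ring
      have h2 : ((h + 3 : ℕ) : ℝ) * θ = ((h + 1 : ℕ) + 1) * θ + θ := by push_cast; ring
      rw [h1, h2, Real.cos_sub, Real.cos_add]; ring
    simp only [this, groundIndicator, mul_zero]
    rw [intervalIntegral.integral_const_mul, intervalIntegral.integral_sub
      (Continuous.intervalIntegrable (by fun_prop) _ _)
      (Continuous.intervalIntegrable (by fun_prop) _ _),
      integral_cos_nat_mul_eq_zero (by omega), integral_cos_nat_mul_eq_zero (by omega)]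
    simp

/-- Multiplying by `q ^ h` makes the transfer operator symmetric. Its generalized eigenfunctions are
`sin((h+1)θ)`, with eigenvalue `1 + 2q cos θ`; they vanish at height `-1`, as the wall requires. -/
theorem pow_mul_pathWeight_eq_integral (q : ℝ) (n h : ℕ) :
    q ^ h * pathWeight (q ^ 2) n h = 2 / Real.pi * ∫ θ in (0 : ℝ)..Real.pi,
      (1 + 2 * q * Real.cos θ) ^ n * (Real.sin θ * Real.sin ((h + 1) * θ)) := by
  induction n generalizing h with
  | zero =>
    simp only [pow_zero, one_mul, integral_sin_mul_sin_succ, pathWeight, Function.iterate_zero, id]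
    have := Real.pi_ne_zero
    rcases h with _ | h
    · simp only [groundIndicator]; field_simp
    · simp [groundIndicator]
  | succ n ih =>
    have hint : ∀ k : ℝ, IntervalIntegrable (fun θ : ℝ =>
        (1 + 2 * q * Real.cos θ) ^ n * (Real.sin θ * Real.sin (k * θ)))
        MeasureTheory.volume 0 Real.pi :=
      fun k => Continuous.intervalIntegrable (by fun_prop) _ _
    rw [pathWeight, Function.iterate_succ_apply', ← pathWeight]
    have hfun : ∀ θ : ℝ, (1 + 2 * q * Real.cos θ) ^ (n + 1)
          * (Real.sin θ * Real.sin (((h : ℕ) + 1) * θ))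
        = (1 + 2 * q * Real.cos θ) ^ n * (Real.sin θ * Real.sin (((h : ℕ) + 1) * θ))
        + q * ((1 + 2 * q * Real.cos θ) ^ n * (Real.sin θ * Real.sin (((h + 1 : ℕ) + 1) * θ)))
        + q * ((1 + 2 * q * Real.cos θ) ^ n * (Real.sin θ * Real.sin ((h : ℝ) * θ))) := by
      intro θ
      have h1 : (((h + 1 : ℕ) : ℝ) + 1) * θ = (h + 1) * θ + θ := by push_cast; ring
      have h2 : (h : ℝ) * θ = (h + 1) * θ - θ := by ring
      rw [h1, h2, Real.sin_sub, Real.sin_add]; ring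
    simp only [hfun]
    rw [intervalIntegral.integral_add (((hint _).add ((hint _).const_mul _)))
      ((hint _).const_mul _), intervalIntegral.integral_add (hint _) ((hint _).const_mul _),
      intervalIntegral.integral_const_mul, intervalIntegral.integral_const_mul,
      mul_add, mul_add, mul_left_comm _ q, mul_left_comm _ q, ← ih, ← ih]
    rcases h with _ | h
    · simp [transfer]; ring
    · have hh := ih h
      have : ((h + 1 : ℕ) : ℝ) = h + 1 := by push_cast; ring
      rw [this, ← hh, transfer]; ring

/-- The substitution `t = 1 - cos θ` puts the maximum of the base at `t = 0`, with an algebraic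
weight suited to Beta integrals. -/
theorem pathWeight_zero_eq_integral (q : ℝ) (n : ℕ) :
    pathWeight (q ^ 2) n 0 = 2 / Real.pi * ∫ t in (0 : ℝ)..2,
      (2 * q + 1 - 2 * q * t) ^ n * Real.sqrt (t * (2 - t)) := by
  have h := pow_mul_pathWeight_eq_integral q n 0
  rw [pow_zero, one_mul] at h
  rw [h]
  congr 1
  have hsub := intervalIntegral.integral_comp_mul_deriv' (a := 0) (b := Real.pi)
    (f := fun θ : ℝ => 1 - Real.cos θ) (f' := fun θ : ℝ => Real.sin θ)
    (g := fun t => (2 * q + 1 - 2 * q * t) ^ n * Real.sqrt (t * (2 - t)))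
    (fun x _ => by simpa using (Real.hasDerivAt_cos x).const_sub 1)
    (by fun_prop) (by fun_prop)
  simp only [Real.cos_zero, sub_self, Real.cos_pi] at hsub
  rw [show (1 : ℝ) - -1 = 2 by norm_num] at hsub
  rw [← hsub]
  refine intervalIntegral.integral_congr fun θ hθ => ?_
  rw [Set.uIcc_of_le Real.pi_pos.le] at hθ
  have hs : Real.sqrt ((1 - Real.cos θ) * (2 - (1 - Real.cos θ))) = Real.sin θ := by
    rw [show (1 - Real.cos θ) * (2 - (1 - Real.cos θ)) = Real.sin θ ^ 2 by
      rw [Real.sin_sq]; ring]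
    exact Real.sqrt_sq (Real.sin_nonneg_of_mem_Icc hθ)
  simp only [Function.comp, hs]
  push_cast
  ring_nf

/-! ### Beta integrals -/

theorem integral_one_sub_pow_mul_rpow {a : ℝ} (ha : 0 < a) (n : ℕ) :
    ∫ x in (0 : ℝ)..1, (1 - x) ^ n * x ^ (a - 1)
      = Real.Gamma a * Real.Gamma (n + 1) / Real.Gamma (a + (n + 1)) := by
  have h := Complex.betaIntegral_eq_Gamma_mul_div a (n + 1 : ℝ) (by simpa using ha)
    (by simp; positivity)
  rw [Complex.betaIntegral, ← Complex.ofReal_add, Complex.Gamma_ofReal, Complex.Gamma_ofReal,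
    Complex.Gamma_ofReal] at h
  have h2 : ∫ x in (0 : ℝ)..1, (x : ℂ) ^ ((a : ℂ) - 1) * (1 - (x : ℂ)) ^ (((n + 1 : ℝ) : ℂ) - 1)
      = ∫ x in (0 : ℝ)..1, (((1 - x) ^ n * x ^ (a - 1) : ℝ) : ℂ) := by
    refine intervalIntegral.integral_congr fun x hx => ?_
    rw [Set.uIcc_of_le zero_le_one] at hx
    have e : (((n + 1 : ℝ) : ℂ) - 1) = (n : ℂ) := by push_cast; ring
    simp only [e, Complex.cpow_natCast]
    push_cast
    rw [Complex.ofReal_cpow hx.1]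
    push_cast
    ring
  rw [h2, intervalIntegral.integral_ofReal] at h
  exact_mod_cast h

/-- Log-convexity of `Gamma` between `x` and `x + 1`. -/
theorem Gamma_add_half_le {x : ℝ} (hx : 0 < x) :
    Real.Gamma (x + 1 / 2) ≤ Real.sqrt x * Real.Gamma x := by
  have h := Real.Gamma_mul_add_mul_le_rpow_Gamma_mul_rpow_Gamma hx (t := x + 1) (by linarith)
    (a := 1 / 2) (b := 1 / 2) (by norm_num) (by norm_num) (by norm_num)
  have hG := Real.Gamma_pos_of_pos hx
  rw [Real.Gamma_add_one hx.ne', ← Real.sqrt_eq_rpow, ← Real.sqrt_eq_rpow,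
    Real.sqrt_mul hx.le, mul_left_comm, Real.mul_self_sqrt hG.le] at h
  convert h using 2
  ring

theorem Gamma_natCast_add_three_half_le (n : ℕ) :
    Real.Gamma (n + 3 / 2) ≤ Real.sqrt (n + 1) * Real.Gamma (n + 1) := by
  have := Gamma_add_half_le (x := (n : ℝ) + 1) (by positivity)
  rwa [show (n : ℝ) + 1 + 1 / 2 = n + 3 / 2 by ring] at this

theorem le_Gamma_natCast_add_three_half (n : ℕ) :
    Real.sqrt n * Real.Gamma (n + 1) ≤ Real.Gamma (n + 3 / 2) := by
  have hx : (0 : ℝ) < n + 1 / 2 := by positivity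
  have h := Gamma_add_half_le hx
  rw [show (n : ℝ) + 1 / 2 + 1 / 2 = n + 1 by ring] at h
  have h2 := Real.Gamma_add_one hx.ne'
  rw [show (n : ℝ) + 1 / 2 + 1 = n + 3 / 2 by ring] at h2
  rw [h2]
  have hG := Real.Gamma_pos_of_pos hx
  calc Real.sqrt n * Real.Gamma (n + 1)
      ≤ Real.sqrt (n + 1 / 2) * (Real.sqrt (n + 1 / 2) * Real.Gamma (n + 1 / 2)) := by
        gcongr
        linarith
    _ = _ := by rw [← mul_assoc, Real.mul_self_sqrt hx.le]

/-- `∫₀¹ (1 - x)ⁿ √x dx`. -/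
noncomputable def betaHalf (n : ℕ) : ℝ := ∫ x in (0 : ℝ)..1, (1 - x) ^ n * Real.sqrt x

theorem Gamma_three_half : Real.Gamma (3 / 2) = Real.sqrt Real.pi / 2 := by
  rw [show (3 / 2 : ℝ) = 1 / 2 + 1 by norm_num, Real.Gamma_add_one (by norm_num),
    Real.Gamma_one_half_eq]; ring

theorem betaHalf_eq (n : ℕ) : betaHalf n = Real.sqrt Real.pi / 2 *
    (Real.Gamma (n + 1) / ((n + 3 / 2) * Real.Gamma (n + 3 / 2))) := by
  have h := integral_one_sub_pow_mul_rpow (a := 3 / 2) (by norm_num) n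
  rw [Gamma_three_half, show (3 / 2 : ℝ) + (n + 1) = (n + 3 / 2) + 1 by ring,
    Real.Gamma_add_one (s := (n : ℝ) + 3 / 2) (by positivity), mul_div_assoc] at h
  rw [← h, betaHalf]
  refine intervalIntegral.integral_congr fun x _ => ?_
  simp only [Real.sqrt_eq_rpow]
  norm_num

theorem integral_one_sub_pow_mul_sqrt_cube (n : ℕ) :
    ∫ x in (0 : ℝ)..1, (1 - x) ^ n * (x * Real.sqrt x) = 3 / 2 / (n + 5 / 2) * betaHalf n := by
  have h := integral_one_sub_pow_mul_rpow (a := 5 / 2) (by norm_num) n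
  rw [show (5 / 2 : ℝ) + (n + 1) = ((n + 3 / 2) + 1) + 1 by ring,
    Real.Gamma_add_one (s := (n : ℝ) + 3 / 2 + 1) (by positivity),
    Real.Gamma_add_one (s := (n : ℝ) + 3 / 2) (by positivity),
    show (5 / 2 : ℝ) = 3 / 2 + 1 by norm_num, Real.Gamma_add_one (s := 3 / 2) (by norm_num),
    Gamma_three_half] at h
  have hG : (0 : ℝ) < Real.Gamma (n + 3 / 2) := Real.Gamma_pos_of_pos (by positivity)
  have e : ∫ x in (0 : ℝ)..1, (1 - x) ^ n * (x * Real.sqrt x)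
      = ∫ x in (0 : ℝ)..1, (1 - x) ^ n * x ^ (3 / 2 + 1 - 1 : ℝ) := by
    refine intervalIntegral.integral_congr fun x hx => ?_
    rw [Set.uIcc_of_le zero_le_one] at hx
    have : x ^ (3 / 2 + 1 - 1 : ℝ) = x * Real.sqrt x := by
      rw [Real.sqrt_eq_rpow, show (3 / 2 + 1 - 1 : ℝ) = 1 + 1 / 2 by norm_num,
        Real.rpow_add_of_nonneg hx.1 (by norm_num) (by norm_num), Real.rpow_one]
    simp only [this]
  rw [e, h, betaHalf_eq]
  have h1 : (n : ℝ) + 3 / 2 ≠ 0 := by positivity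
  have h2 : (n : ℝ) + 5 / 2 ≠ 0 := by positivity
  rw [show (n : ℝ) + 3 / 2 + 1 = n + 5 / 2 by ring]
  field_simp

theorem betaHalf_asymp {n : ℕ} (hn : 1 ≤ n) :
    0 ≤ betaHalf n ∧ betaHalf n * (n * Real.sqrt n) ≤ Real.sqrt Real.pi / 2 ∧
    Real.sqrt Real.pi / 2 * (1 - 5 / (2 * n)) ≤ betaHalf n * (n * Real.sqrt n) := by
  have hn0 : (1 : ℝ) ≤ n := by exact_mod_cast hn
  have hG : (0 : ℝ) < Real.Gamma (n + 3 / 2) := Real.Gamma_pos_of_pos (by positivity)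
  have hG1 : (0 : ℝ) < Real.Gamma (n + 1) := Real.Gamma_pos_of_pos (by positivity)
  have hp : 0 ≤ Real.sqrt Real.pi / 2 := by positivity
  rw [betaHalf_eq]
  refine ⟨by positivity, ?_, ?_⟩
  · rw [mul_assoc]
    refine mul_le_of_le_one_right hp ?_
    rw [div_mul_eq_mul_div, div_le_one (by positivity)]
    have := le_Gamma_natCast_add_three_half n
    nlinarith
  · rw [mul_assoc]
    refine mul_le_mul_of_nonneg_left ?_ hp
    rw [div_mul_eq_mul_div, le_div_iff₀ (by positivity)]
    have h1 := Gamma_natCast_add_three_half_le n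
    have hs : 0 < Real.sqrt n := Real.sqrt_pos.mpr (by linarith)
    have h2 : Real.sqrt (n + 1) * Real.sqrt n ≤ n + 1 := by
      rw [← Real.sqrt_mul (by positivity), Real.sqrt_le_left (by positivity)]; nlinarith
    have h3 : Real.sqrt n * Real.sqrt n = n := Real.mul_self_sqrt (by positivity)
    have h4 : Real.sqrt (n + 1) * n ≤ (n + 1) * Real.sqrt n := by
      nlinarith
    rcases le_or_gt (1 - 5 / (2 * (n : ℝ))) 0 with h0 | h0
    · exact (mul_nonpos_of_nonpos_of_nonneg h0 (by positivity)).trans (by positivity)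
    · have h5 : Real.Gamma (n + 3 / 2) * n ≤ (n + 1) * Real.sqrt n * Real.Gamma (n + 1) := by
        calc _ ≤ Real.sqrt (n + 1) * Real.Gamma (n + 1) * n := by gcongr
          _ = (Real.sqrt (n + 1) * n) * Real.Gamma (n + 1) := by ring
          _ ≤ _ := by gcongr
      -- The constant `5/2 = 3/2 + 1` cancels the linear term of `(n + 3/2)(n + 1)`.
      have h6 : (1 - 5 / (2 * (n : ℝ))) * (n + 3 / 2) * (n + 1) ≤ n * n := by
        have : 5 / (2 * (n : ℝ)) * n = 5 / 2 := by field_simp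
        have h7 : 0 ≤ 5 / (2 * (n : ℝ)) := by positivity
        nlinarith
      refine le_of_mul_le_mul_right ?_ (by linarith : (0 : ℝ) < n)
      calc _ = (1 - 5 / (2 * (n : ℝ))) * (n + 3 / 2) * (Real.Gamma (n + 3 / 2) * n) := by ring
        _ ≤ (1 - 5 / (2 * (n : ℝ))) * (n + 3 / 2) *
            ((n + 1) * Real.sqrt n * Real.Gamma (n + 1)) := by gcongr
        _ = (1 - 5 / (2 * (n : ℝ))) * (n + 3 / 2) * (n + 1) *
            (Real.sqrt n * Real.Gamma (n + 1)) := by ring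
        _ ≤ n * n * (Real.sqrt n * Real.Gamma (n + 1)) := by gcongr
        _ = _ := by ring

/-! ### Asymptotics of the path weights -/

theorem integral_one_sub_div_pow_mul_sqrt {T : ℝ} (hT : 0 < T) (n : ℕ) :
    ∫ t in (0 : ℝ)..T, (1 - t / T) ^ n * Real.sqrt t = T * Real.sqrt T * betaHalf n := by
  have h := intervalIntegral.integral_comp_mul_left
    (fun t => (1 - t / T) ^ n * Real.sqrt t) hT.ne' (a := 0) (b := 1)
  rw [mul_zero, mul_one, smul_eq_mul, eq_inv_mul_iff_mul_eq₀ hT.ne'] at h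
  rw [← h, betaHalf, mul_assoc]
  simp only [← intervalIntegral.integral_const_mul]
  refine intervalIntegral.integral_congr fun x _ => ?_
  simp only [mul_div_cancel_left₀ x hT.ne', Real.sqrt_mul hT.le]
  ring

theorem integral_one_sub_div_pow_mul_sqrt_cube {T : ℝ} (hT : 0 < T) (n : ℕ) :
    ∫ t in (0 : ℝ)..T, (1 - t / T) ^ n * (t * Real.sqrt t)
      = T * (T * Real.sqrt T) * (3 / 2 / (n + 5 / 2) * betaHalf n) := by
  have h := intervalIntegral.integral_comp_mul_left
    (fun t => (1 - t / T) ^ n * (t * Real.sqrt t)) hT.ne' (a := 0) (b := 1)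
  rw [mul_zero, mul_one, smul_eq_mul, eq_inv_mul_iff_mul_eq₀ hT.ne'] at h
  rw [← h, ← integral_one_sub_pow_mul_sqrt_cube, mul_assoc]
  simp only [← intervalIntegral.integral_const_mul]
  refine intervalIntegral.integral_congr fun x _ => ?_
  simp only [mul_div_cancel_left₀ x hT.ne', Real.sqrt_mul hT.le]
  ring

theorem abs_sqrt_two_sub_sub_sqrt_two_le {t : ℝ} (h0 : 0 ≤ t) (h2 : t ≤ 2) :
    |Real.sqrt (2 - t) - Real.sqrt 2| ≤ t := by
  have h1 : Real.sqrt (2 - t) ≤ Real.sqrt 2 := Real.sqrt_le_sqrt (by linarith)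
  have h3 : 1 ≤ Real.sqrt 2 := Real.one_le_sqrt.mpr (by norm_num)
  have h4 : 0 ≤ Real.sqrt (2 - t) := Real.sqrt_nonneg _
  have h5 : Real.sqrt (2 - t) * Real.sqrt (2 - t) = 2 - t := Real.mul_self_sqrt (by linarith)
  have h6 : Real.sqrt 2 * Real.sqrt 2 = 2 := Real.mul_self_sqrt (by norm_num)
  rw [abs_sub_comm, abs_of_nonneg (by linarith)]
  nlinarith

/-- On `[0, T]` the base is nonnegative and replacing `√(2 - t)` by `√2` costs a factor `t`, hence
the first error term. On `[T, 2]`, of length at most one, the base is negative with modulus at most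
`2/T - 1`. -/
theorem abs_integral_sub_betaHalf_le {T : ℝ} (h1 : 1 ≤ T) (h2 : T ≤ 3 / 2) (n : ℕ) :
    |(∫ t in (0 : ℝ)..2, (1 - t / T) ^ n * Real.sqrt (t * (2 - t)))
        - Real.sqrt 2 * (T * Real.sqrt T * betaHalf n)|
      ≤ T * (T * Real.sqrt T) * (3 / 2 / (n + 5 / 2) * betaHalf n) + (2 / T - 1) ^ n := by
  have hT : 0 < T := by linarith
  have hc : ∀ a b : ℝ, IntervalIntegrable
      (fun t : ℝ => (1 - t / T) ^ n * Real.sqrt (t * (2 - t))) MeasureTheory.volume a b :=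
    fun a b => Continuous.intervalIntegrable (by fun_prop) _ _
  have hc' : ∀ a b : ℝ, IntervalIntegrable
      (fun t : ℝ => (1 - t / T) ^ n * Real.sqrt t) MeasureTheory.volume a b :=
    fun a b => Continuous.intervalIntegrable (by fun_prop) _ _
  rw [← intervalIntegral.integral_add_adjacent_intervals (hc 0 T) (hc T 2),
    ← integral_one_sub_div_pow_mul_sqrt hT, ← integral_one_sub_div_pow_mul_sqrt_cube hT,
    add_sub_right_comm, ← intervalIntegral.integral_const_mul,
    ← intervalIntegral.integral_sub (hc _ _) ((hc' _ _).const_mul _)]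
  refine (abs_add_le _ _).trans (add_le_add ?_ ?_)
  · refine (intervalIntegral.abs_integral_le_integral_abs hT.le).trans ?_
    refine intervalIntegral.integral_mono_on hT.le
      (Continuous.intervalIntegrable (by fun_prop) _ _)
      (Continuous.intervalIntegrable (by fun_prop) _ _) fun t ht => ?_
    have h3 : 0 ≤ 1 - t / T := by
      rw [sub_nonneg, div_le_one hT]; exact ht.2
    rw [Real.sqrt_mul ht.1, show (1 - t / T) ^ n * (Real.sqrt t * Real.sqrt (2 - t))
      - Real.sqrt 2 * ((1 - t / T) ^ n * Real.sqrt t)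
      = (1 - t / T) ^ n * ((Real.sqrt (2 - t) - Real.sqrt 2) * Real.sqrt t) by ring, abs_mul,
      abs_mul, abs_of_nonneg (pow_nonneg h3 n), abs_of_nonneg (Real.sqrt_nonneg t)]
    gcongr
    exact abs_sqrt_two_sub_sub_sqrt_two_le ht.1 (by linarith [ht.2])
  · have hb : ∀ t ∈ Set.uIoc T 2, ‖(1 - t / T) ^ n * Real.sqrt (t * (2 - t))‖
        ≤ (2 / T - 1) ^ n := by
      intro t ht
      rw [Set.uIoc_of_le (by linarith)] at ht
      rw [norm_mul, norm_pow, Real.norm_eq_abs, Real.norm_eq_abs,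
        abs_of_nonneg (Real.sqrt_nonneg _)]
      have h3 : Real.sqrt (t * (2 - t)) ≤ 1 := by
        exact Real.sqrt_le_iff.mpr ⟨by norm_num, by nlinarith [sq_nonneg (t - 1)]⟩
      have h4 : |1 - t / T| ≤ 2 / T - 1 := by
        have : 1 < t / T := (one_lt_div hT).mpr ht.1
        have : t / T ≤ 2 / T := by gcongr; exact ht.2
        rw [abs_of_nonpos (by linarith)]; linarith
      have h5 : 0 ≤ 2 / T - 1 := (abs_nonneg _).trans h4
      calc _ ≤ (2 / T - 1) ^ n * 1 := by gcongr
        _ = _ := mul_one _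
    have := intervalIntegral.norm_integral_le_of_norm_le_const hb
    rw [Real.norm_eq_abs] at this
    refine this.trans ?_
    have h5 : 0 ≤ 2 / T - 1 := by
      rw [sub_nonneg, one_le_div hT]; linarith
    refine mul_le_of_le_one_right (pow_nonneg h5 n) ?_
    rw [abs_of_nonneg (by linarith)]; linarith

theorem exists_pow_mul_le {r : ℝ} (h0 : 0 ≤ r) (h1 : r < 1) :
    ∃ C : ℝ, 0 < C ∧ ∀ n : ℕ, 1 ≤ n → r ^ n * (n * Real.sqrt n) ≤ C / n := by
  obtain ⟨C, hC⟩ := (tendsto_pow_const_mul_const_pow_of_lt_one 3 h0 h1).bddAbove_range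
  refine ⟨max C 1, by positivity, fun n hn => ?_⟩
  have hn0 : (1 : ℝ) ≤ n := by exact_mod_cast hn
  have h := hC ⟨n, rfl⟩
  simp only at h
  rw [le_div_iff₀ (by linarith)]
  have hs : Real.sqrt n ≤ n := by
    rw [Real.sqrt_le_left (by linarith)]; nlinarith
  calc r ^ n * (n * Real.sqrt n) * n ≤ r ^ n * (n * n) * n := by gcongr
    _ = n ^ 3 * r ^ n := by ring
    _ ≤ _ := h.trans (le_max_left _ _)

/-- The constant in the asymptotics of the number of coloured Motzkin walks. -/
noncomputable def growthConst (q : ℝ) : ℝ :=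
  1 / (2 * Real.sqrt Real.pi * (q / (2 * q + 1) * Real.sqrt (q / (2 * q + 1))))

theorem growthConst_eq {q : ℝ} (hq : 0 < q) :
    2 / Real.pi * (Real.sqrt 2 * ((2 * q + 1) / (2 * q) * Real.sqrt ((2 * q + 1) / (2 * q)) *
      (Real.sqrt Real.pi / 2))) = growthConst q := by
  have e : (2 * q + 1) / (2 * q) = (q / (2 * q + 1))⁻¹ / 2 := by field_simp
  rw [e, growthConst, Real.sqrt_div (by positivity), Real.sqrt_inv]
  have hσ : 0 < q / (2 * q + 1) := by positivity
  set σ := q / (2 * q + 1)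
  have h1 : Real.sqrt Real.pi * Real.sqrt Real.pi = Real.pi := Real.mul_self_sqrt Real.pi_pos.le
  have h2 : 0 < Real.sqrt Real.pi := Real.sqrt_pos.mpr Real.pi_pos
  have h3 : 0 < Real.sqrt σ := Real.sqrt_pos.mpr hσ
  have h4 : 0 < Real.sqrt 2 := Real.sqrt_pos.mpr (by norm_num)
  rw [← h1]
  field_simp
  rw [Real.sqrt_sq h2.le]

/-- Dividing by `(2q+1)^n` makes the base `1 - t/T`. The three terms of the constant come from the
Beta asymptotics, from freezing `√(2 - t)`, and from the exponentially small part beyond `T`. -/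
theorem exists_abs_pathWeight_sub_le {q : ℝ} (hq : 1 ≤ q) :
    ∃ C : ℝ, 0 < C ∧ ∀ n : ℕ, 1 ≤ n →
      |pathWeight (q ^ 2) n 0 / (2 * q + 1) ^ n * (n * Real.sqrt n) - growthConst q| ≤ C / n := by
  set T : ℝ := (2 * q + 1) / (2 * q) with hTdef
  have hq0 : 0 < q := by linarith
  have hT1 : 1 < T := by rw [hTdef, one_lt_div (by positivity)]; linarith
  have hT2 : T ≤ 3 / 2 := by rw [hTdef, div_le_div_iff₀ (by positivity) (by norm_num)]; linarith
  have hT0 : 0 < T := by linarith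
  obtain ⟨C₀, hC₀, hr⟩ := exists_pow_mul_le (r := 2 / T - 1)
    (by rw [sub_nonneg, one_le_div hT0]; linarith)
    (by rw [sub_lt_iff_lt_add, div_lt_iff₀ hT0]; linarith)
  set P := Real.sqrt Real.pi / 2 with hP
  have hP0 : 0 < P := by have := Real.pi_pos; positivity
  set D := T * Real.sqrt T with hD
  have hD0 : 0 < D := by positivity
  refine ⟨2 / Real.pi * (Real.sqrt 2 * (D * (P * (5 / 2))) + T * D * (3 / 2 * P) + C₀),
    by have := Real.pi_pos; positivity, fun n hn => ?_⟩
  have hn0 : (1 : ℝ) ≤ n := by exact_mod_cast hn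
  have hs : 0 < Real.sqrt n := Real.sqrt_pos.mpr (by linarith)
  have hm : pathWeight (q ^ 2) n 0 / (2 * q + 1) ^ n
      = 2 / Real.pi * ∫ t in (0 : ℝ)..2, (1 - t / T) ^ n * Real.sqrt (t * (2 - t)) := by
    rw [pathWeight_zero_eq_integral, mul_div_assoc, ← intervalIntegral.integral_div]
    congr 1
    refine intervalIntegral.integral_congr fun t _ => ?_
    have : 1 - t / T = (2 * q + 1 - 2 * q * t) / (2 * q + 1) := by
      rw [hTdef]; field_simp
    simp only [this, div_pow]
    ring
  obtain ⟨hb0, hb1, hb2⟩ := betaHalf_asymp hn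
  have hI := abs_integral_sub_betaHalf_le hT1.le hT2 n
  rw [hm, ← growthConst_eq hq0, ← hTdef, ← hD, ← hP]
  set I := ∫ t in (0 : ℝ)..2, (1 - t / T) ^ n * Real.sqrt (t * (2 - t))
  set N := (n : ℝ) * Real.sqrt n with hN
  have hN0 : 0 < N := by positivity
  have hpi : 0 < 2 / Real.pi := by have := Real.pi_pos; positivity
  have e1 : 2 / Real.pi * I * N - 2 / Real.pi * (Real.sqrt 2 * (D * P))
      = 2 / Real.pi * ((I - Real.sqrt 2 * (D * betaHalf n)) * N
        + Real.sqrt 2 * (D * (betaHalf n * N - P))) := by ring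
  rw [e1, abs_mul, abs_of_pos hpi, mul_div_assoc]
  refine mul_le_mul_of_nonneg_left ((abs_add_le _ _).trans ?_) hpi.le
  have b1 : |Real.sqrt 2 * (D * (betaHalf n * N - P))|
      ≤ Real.sqrt 2 * (D * (P * (5 / 2))) / n := by
    rw [abs_mul, abs_mul, abs_of_nonneg (Real.sqrt_nonneg 2), abs_of_pos hD0, mul_div_assoc,
      mul_div_assoc, mul_div_assoc]
    gcongr
    rw [← hP] at hb1
    rw [abs_of_nonpos (by linarith)]
    have : 5 / (2 * (n : ℝ)) = 5 / 2 / n := by field_simp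
    rw [this, ← hP] at hb2
    linarith
  have b2 : |(I - Real.sqrt 2 * (D * betaHalf n)) * N|
      ≤ T * D * (3 / 2 * P) / n + C₀ / n := by
    rw [abs_mul, abs_of_pos hN0]
    refine (mul_le_mul_of_nonneg_right hI hN0.le).trans ?_
    rw [add_mul]
    refine add_le_add ?_ (hr n hn)
    have h3 : 3 / 2 / ((n : ℝ) + 5 / 2) ≤ 3 / 2 / n := by
      gcongr; linarith
    calc T * D * (3 / 2 / ((n : ℝ) + 5 / 2) * betaHalf n) * N
        = T * D * (3 / 2 / ((n : ℝ) + 5 / 2) * (betaHalf n * N)) := by ring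
      _ ≤ T * D * (3 / 2 / n * P) := by gcongr
      _ = _ := by ring
  calc _ ≤ (T * D * (3 / 2 * P) / n + C₀ / n) + Real.sqrt 2 * (D * (P * (5 / 2))) / n :=
        add_le_add b2 b1
    _ = _ := by ring

/-! ### Ratios of path weights -/

theorem pathWeight_nonneg {s : ℝ} (hs : 0 ≤ s) (n h : ℕ) : 0 ≤ pathWeight s n h := by
  induction n generalizing h with
  | zero => rcases h with _ | h <;> simp [pathWeight, groundIndicator]
  | succ n ih =>
    rw [pathWeight, Function.iterate_succ_apply', ← pathWeight]
    rcases h with _ | h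
    · exact add_nonneg (ih 0) (mul_nonneg hs (ih 1))
    · exact add_nonneg (add_nonneg (ih _) (mul_nonneg hs (ih _))) (ih _)

theorem one_le_pathWeight_zero {s : ℝ} (hs : 0 ≤ s) (n : ℕ) : 1 ≤ pathWeight s n 0 := by
  induction n with
  | zero => simp [pathWeight, groundIndicator]
  | succ n ih =>
    rw [pathWeight, Function.iterate_succ_apply', ← pathWeight]
    have := mul_nonneg hs (pathWeight_nonneg hs n 1)
    simp only [transfer]
    linarith

/-- The path weight of length `n`, divided by its exponential growth. -/
noncomputable def scaledWeight (q : ℝ) (n : ℕ) : ℝ := pathWeight (q ^ 2) n 0 / (2 * q + 1) ^ n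

theorem scaledWeight_pos {q : ℝ} (hq : 0 < q) (n : ℕ) : 0 < scaledWeight q n :=
  div_pos (zero_lt_one.trans_le (one_le_pathWeight_zero (by positivity) n)) (by positivity)

theorem growthConst_pos {q : ℝ} (hq : 0 < q) : 0 < growthConst q := by
  have := Real.pi_pos
  rw [growthConst]; positivity

theorem exists_le_scaledWeight_mul {q : ℝ} (hq : 1 ≤ q) :
    ∃ d : ℝ, 0 < d ∧ ∀ n : ℕ, 1 ≤ n → d ≤ scaledWeight q n * (n * Real.sqrt n) := by
  obtain ⟨C, hC, h⟩ := exists_abs_pathWeight_sub_le hq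
  have hc := growthConst_pos (zero_lt_one.trans_le hq)
  -- From `N` on the asymptotic error is at most half the limit; the finitely many smaller lengths
  -- use that a path weight is at least one.
  obtain ⟨N, hN⟩ := exists_nat_ge (2 * C / growthConst q)
  have hl : 0 < 2 * q + 1 := by linarith
  refine ⟨min (growthConst q / 2) (1 / (2 * q + 1) ^ N), by positivity, fun n hn => ?_⟩
  have hn0 : (1 : ℝ) ≤ n := by exact_mod_cast hn
  rcases le_total N n with hNn | hNn
  · refine (min_le_left _ _).trans ?_
    have h1 := (abs_le.mp (h n hn)).1
    have h2 : C / n ≤ growthConst q / 2 := by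
      rw [div_le_iff₀ (by linarith)]
      rw [div_le_iff₀ hc] at hN
      have : (N : ℝ) ≤ n := by exact_mod_cast hNn
      nlinarith
    rw [scaledWeight]
    linarith
  · refine (min_le_right _ _).trans ?_
    have h1 : 1 / (2 * q + 1) ^ N ≤ scaledWeight q n := by
      rw [scaledWeight]
      refine div_le_div₀ (zero_le_one.trans (one_le_pathWeight_zero (by positivity) n))
        (one_le_pathWeight_zero (by positivity) n) (by positivity) ?_
      exact pow_le_pow_right₀ (by linarith) hNn
    have h2 : 1 ≤ (n : ℝ) * Real.sqrt n := by
      have := Real.one_le_sqrt.mpr hn0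
      nlinarith
    have h3 : 0 < 1 / (2 * q + 1) ^ N := by positivity
    nlinarith

/-- The increment formula involves lengths `b - 1` and `n - b - 1`, while the profile is expressed
through `b` and `n - b`; the shift costs only `O(1/k)`. -/
theorem exists_abs_scaledWeight_pred_sub_le {q : ℝ} (hq : 1 ≤ q) :
    ∃ C : ℝ, 0 < C ∧ ∀ k : ℕ, 1 ≤ k →
      |scaledWeight q (k - 1) * (k * Real.sqrt k) - growthConst q| ≤ C / k := by
  obtain ⟨C, hC, h⟩ := exists_abs_pathWeight_sub_le hq
  have hc := growthConst_pos (zero_lt_one.trans_le hq)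
  set c := growthConst q
  -- `10 C = 2 · 5 · C` comes from `1/j ≤ 2/(j+1)` and `r ≤ 5`, `8 c` from `r - 1 ≤ 8/(j+1)`; the
  -- `1` covers `k = 1`.
  refine ⟨10 * C + 8 * c + 1, by positivity, fun k hk => ?_⟩
  obtain rfl | ⟨j, rfl, hj⟩ : k = 1 ∨ ∃ j, k = j + 1 ∧ 1 ≤ j := by
    rcases Nat.eq_or_lt_of_le hk with h | h
    · exact Or.inl h.symm
    · exact Or.inr ⟨k - 1, by omega, by omega⟩
  · have : scaledWeight q 0 = 1 := by simp [scaledWeight, pathWeight, groundIndicator]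
    simp only [Nat.sub_self, this, Nat.cast_one, Real.sqrt_one, mul_one, div_one]
    rw [abs_le]; constructor <;> linarith
  · have hj0 : (1 : ℝ) ≤ j := by exact_mod_cast hj
    have hs : 0 < Real.sqrt j := Real.sqrt_pos.mpr (by linarith)
    have hs2 : Real.sqrt j * Real.sqrt j = j := Real.mul_self_sqrt (by linarith)
    rw [Nat.add_sub_cancel]
    have hQ := h j hj
    rw [← scaledWeight] at hQ
    set Q := scaledWeight q j * (j * Real.sqrt j) with hQdef
    set r := ((j : ℝ) + 1) / j * (Real.sqrt (j + 1) / Real.sqrt j) with hr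
    have e : scaledWeight q j * (((j + 1 : ℕ) : ℝ) * Real.sqrt ((j + 1 : ℕ) : ℝ)) = Q * r := by
      have : (j : ℝ) ≠ 0 := by linarith
      rw [hr, hQdef]; push_cast; field_simp
    rw [e]
    have hu1 : 1 ≤ ((j : ℝ) + 1) / j := by rw [one_le_div (by linarith)]; linarith
    have hv1 : 1 ≤ Real.sqrt (j + 1) / Real.sqrt j := by
      rw [one_le_div hs]; exact Real.sqrt_le_sqrt (by linarith)
    have hv2 : Real.sqrt (j + 1) / Real.sqrt j ≤ ((j : ℝ) + 1) / j := by
      rw [← Real.sqrt_div (by linarith), Real.sqrt_le_left (by linarith)]; nlinarith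
    have hr1 : 1 ≤ r := by rw [hr]; nlinarith
    have hr2 : r ≤ 1 + 8 / ((j : ℝ) + 1) := by
      have : r ≤ (((j : ℝ) + 1) / j) * (((j : ℝ) + 1) / j) := by rw [hr]; gcongr
      refine this.trans ?_
      rw [div_mul_div_comm, div_le_iff₀ (by nlinarith)]
      have : 8 / ((j : ℝ) + 1) * (j + 1) = 8 := by field_simp
      have h8 : 0 < 8 / ((j : ℝ) + 1) := by positivity
      have h9 : 8 / ((j : ℝ) + 1) * j = 8 - 8 / ((j : ℝ) + 1) := by linarith
      have h10 : 8 / ((j : ℝ) + 1) ≤ 4 := by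
        rw [div_le_iff₀ (by linarith)]; linarith
      nlinarith
    have h10 : 8 / ((j : ℝ) + 1) ≤ 4 := by
      rw [div_le_iff₀ (by linarith)]; linarith
    have e2 : Q * r - c = (Q - c) * r + c * (r - 1) := by ring
    rw [e2]
    refine (abs_add_le _ _).trans ?_
    rw [abs_mul (Q - c) r, abs_mul c (r - 1), abs_of_pos hc, abs_of_nonneg (by linarith : 0 ≤ r),
      abs_of_nonneg (by linarith : 0 ≤ r - 1)]
    have h11 : C / j ≤ 2 * C / ((j : ℝ) + 1) := by
      rw [div_le_div_iff₀ (by linarith) (by linarith)]; nlinarith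
    calc |Q - c| * r + c * (r - 1) ≤ C / j * 5 + c * (8 / ((j : ℝ) + 1)) := by
          gcongr
          · linarith
          · linarith
      _ ≤ 2 * C / ((j : ℝ) + 1) * 5 + c * (8 / ((j : ℝ) + 1)) := by gcongr
      _ = (10 * C + 8 * c) / ((j : ℝ) + 1) := by ring
      _ ≤ _ := by
          push_cast
          exact div_le_div_of_nonneg_right (by linarith) (by linarith)

/-! ### The bulk parameter -/

/-- `x (1 - x / n)`, comparable to the distance from the ends of the chain. -/
noncomputable def bulk (n : ℕ) (x : ℝ) : ℝ := x * (1 - x / n)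

theorem bulk_eq {n : ℕ} (hn : 1 ≤ n) (x : ℝ) : bulk n x = x * (n - x) / n := by
  have : (n : ℝ) ≠ 0 := by positivity
  rw [bulk]; field_simp

/-- This identity lets errors of order `1/b` and `1/(n-b)` be absorbed into `1/β`. -/
theorem one_div_bulk {n b : ℕ} (hb : 1 ≤ b) (hbn : b < n) :
    1 / bulk n b = 1 / b + 1 / ((n - b : ℕ) : ℝ) := by
  have h1 : (0 : ℝ) < b := by positivity
  have h2 : (0 : ℝ) < (n : ℝ) - b := by rw [sub_pos]; exact_mod_cast hbn
  rw [bulk_eq (by omega), Nat.cast_sub hbn.le]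
  have h3 : (n : ℝ) ≠ 0 := by linarith
  field_simp
  ring

theorem bulk_pos {n b : ℕ} (hb : 1 ≤ b) (hbn : b < n) : 0 < bulk n b := by
  have h1 : (0 : ℝ) < b := by positivity
  have h2 : (0 : ℝ) < ((n - b : ℕ) : ℝ) := by
    have : 0 < n - b := by omega
    positivity
  rw [← one_div_pos, one_div_bulk hb hbn]
  positivity

theorem one_div_bulk_le_two {n b : ℕ} (hb : 1 ≤ b) (hbn : b < n) : 1 / bulk n b ≤ 2 := by
  rw [one_div_bulk hb hbn]
  have h1 : (1 : ℝ) ≤ b := by exact_mod_cast hb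
  have h2 : (1 : ℝ) ≤ ((n - b : ℕ) : ℝ) := by
    have : 1 ≤ n - b := by omega
    exact_mod_cast this
  have h3 : 1 / (b : ℝ) ≤ 1 := by rw [div_le_one (by linarith)]; exact h1
  have h4 : 1 / ((n - b : ℕ) : ℝ) ≤ 1 := by rw [div_le_one (by linarith)]; exact h2
  linarith

theorem one_div_sqrt_bulk_le_two {n b : ℕ} (hb : 1 ≤ b) (hbn : b < n) :
    1 / Real.sqrt (bulk n b) ≤ 2 := by
  have h := one_div_bulk_le_two hb hbn
  have hp := bulk_pos hb hbn
  rw [one_div, ← Real.sqrt_inv, ← one_div, Real.sqrt_le_left (by norm_num)]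
  linarith

/-- Since `β = b(n-b)/n`, the factor `β^(3/2)` supplies exactly the power normalizing each of the
three weights. Each normalized weight is close to `c`, so the ratio is close to `c · c / c`. -/
theorem exists_abs_weightRatio_sub_le {q : ℝ} (hq : 1 ≤ q) :
    ∃ C : ℝ, 0 < C ∧ ∀ n b : ℕ, 1 ≤ b → b < n →
      |scaledWeight q (b - 1) * scaledWeight q (n - b - 1) / scaledWeight q n
        * (bulk n b * Real.sqrt (bulk n b)) - growthConst q| ≤ C / bulk n b := by
  obtain ⟨C₁, hC₁, h₁⟩ := exists_abs_scaledWeight_pred_sub_le hq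
  obtain ⟨C₂, hC₂, h₂⟩ := exists_abs_pathWeight_sub_le hq
  obtain ⟨d, hd, h₃⟩ := exists_le_scaledWeight_mul hq
  have hc := growthConst_pos (zero_lt_one.trans_le hq)
  set c := growthConst q
  refine ⟨(C₁ * (c + C₁) + c * C₁ + c * C₂) / d, by positivity, fun n b hb hbn => ?_⟩
  have hn1 : 1 ≤ n := by omega
  have hnb : 1 ≤ n - b := by omega
  have hb0 : (1 : ℝ) ≤ b := by exact_mod_cast hb
  have hnb0 : (1 : ℝ) ≤ ((n - b : ℕ) : ℝ) := by exact_mod_cast hnb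
  have hcast : ((n - b : ℕ) : ℝ) = n - b := Nat.cast_sub hbn.le
  have hbn' : (b : ℝ) ≤ n := by exact_mod_cast hbn.le
  have hn0 : (0 : ℝ) < n := by linarith
  have hR1 := h₁ b hb
  have hR2 := h₁ (n - b) hnb
  have hQ := h₂ n hn1
  have hQ0 := h₃ n hn1
  rw [← scaledWeight] at hQ
  have hwpos := scaledWeight_pos (zero_lt_one.trans_le hq) n
  have e : scaledWeight q (b - 1) * scaledWeight q (n - b - 1) / scaledWeight q n
        * (bulk n b * Real.sqrt (bulk n b))
      = scaledWeight q (b - 1) * (b * Real.sqrt b)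
        * (scaledWeight q (n - b - 1) * ((n - b : ℕ) * Real.sqrt (n - b : ℕ)))
        / (scaledWeight q n * (n * Real.sqrt n)) := by
    have hs : Real.sqrt (n : ℝ) ≠ 0 := (Real.sqrt_pos.mpr hn0).ne'
    rw [bulk_eq hn1, ← hcast, Real.sqrt_div (by positivity), Real.sqrt_mul (by positivity)]
    field_simp
  rw [e]
  set R1 := scaledWeight q (b - 1) * (b * Real.sqrt b)
  set R2 := scaledWeight q (n - b - 1) * ((n - b : ℕ) * Real.sqrt (n - b : ℕ))
  set Q := scaledWeight q n * (n * Real.sqrt n)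
  have hQpos : 0 < Q := hd.trans_le hQ0
  -- Telescoping replaces the factors by `c` one at a time.
  have e2 : R1 * R2 / Q - c = ((R1 - c) * R2 + c * (R2 - c) + c * (c - Q)) / Q := by
    field_simp
    ring
  have hR2' : |R2| ≤ c + C₁ := by
    have h4 : C₁ / ((n - b : ℕ) : ℝ) ≤ C₁ := div_le_self hC₁.le hnb0
    have := abs_le.mp (hR2.trans h4)
    rw [abs_le]; constructor <;> linarith
  have hn2 : C₂ / (n : ℝ) ≤ C₂ / b := by gcongr
  have hβ := one_div_bulk hb hbn
  rw [e2, abs_div, abs_of_pos hQpos]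
  have hnum : |(R1 - c) * R2 + c * (R2 - c) + c * (c - Q)|
      ≤ (C₁ * (c + C₁) + c * C₁ + c * C₂) / bulk n b := by
    refine (abs_add_le _ _).trans ((add_le_add_left (abs_add_le _ _) _).trans ?_)
    rw [abs_mul (R1 - c) R2, abs_mul c (R2 - c), abs_mul c (c - Q), abs_of_pos hc,
      abs_sub_comm c Q]
    calc |R1 - c| * |R2| + c * |R2 - c| + c * |Q - c|
        ≤ C₁ / b * (c + C₁) + c * (C₁ / (n - b : ℕ)) + c * (C₂ / b) := by
          gcongr
          exact hQ.trans hn2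
      _ = C₁ * (c + C₁) * (1 / b) + c * C₁ * (1 / (n - b : ℕ)) + c * C₂ * (1 / b) := by ring
      _ ≤ C₁ * (c + C₁) * (1 / bulk n b) + c * C₁ * (1 / bulk n b) + c * C₂ * (1 / bulk n b) := by
          have p1 : 0 ≤ 1 / (b : ℝ) := by positivity
          have p2 : 0 ≤ 1 / ((n - b : ℕ) : ℝ) := by positivity
          refine add_le_add (add_le_add ?_ ?_) ?_ <;>
            refine mul_le_mul_of_nonneg_left ?_ (by positivity) <;> rw [hβ] <;> linarith
      _ = _ := by ring
  calc _ ≤ (C₁ * (c + C₁) + c * C₁ + c * C₂) / bulk n b / d :=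
        div_le_div₀ (by have := bulk_pos hb hbn; positivity) hnum hd hQ0
    _ = _ := by ring

/-! ### The profile -/

/-- The shape `(1 - 2x/n) / √(x (1 - x/n))` of the magnetization profile. -/
noncomputable def profile (n : ℕ) (x : ℝ) : ℝ := (1 - 2 * x / n) / Real.sqrt (bulk n x)

theorem hasDerivAt_profile {n : ℕ} (hn : 1 ≤ n) {x : ℝ} (hx : 0 < bulk n x) :
    HasDerivAt (profile n) (-(1 / (2 * (bulk n x * Real.sqrt (bulk n x))))) x := by
  have hn0 : (n : ℝ) ≠ 0 := by positivity
  have h1 : HasDerivAt (fun x : ℝ => 1 - 2 * x / n) (-(2 / n)) x := by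
    have := (((hasDerivAt_id x).const_mul 2).div_const (n : ℝ)).const_sub 1
    simpa using this
  have h2 : HasDerivAt (bulk n) (1 - 2 * x / n) x := by
    have h := (hasDerivAt_id x).mul (((hasDerivAt_id x).div_const (n : ℝ)).const_sub 1)
    refine h.congr_deriv ?_
    simp only [id]
    ring
  have hs : 0 < Real.sqrt (bulk n x) := Real.sqrt_pos.mpr hx
  refine (h1.div (h2.sqrt hx.ne') hs.ne').congr_deriv ?_
  have hsq : Real.sqrt (bulk n x) ^ 2 = bulk n x := Real.sq_sqrt hx.le
  -- This identity collapses the numerator of the quotient rule to a constant.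
  have key : 4 * bulk n x / n + (1 - 2 * x / n) ^ 2 = 1 := by
    rw [bulk]; ring
  rw [hsq]
  have hb : bulk n x = Real.sqrt (bulk n x) * Real.sqrt (bulk n x) := by rw [← sq, hsq]
  rw [div_eq_iff hx.ne']
  have : -(1 / (2 * (bulk n x * Real.sqrt (bulk n x)))) * bulk n x
      = -(1 / (2 * Real.sqrt (bulk n x))) := by field_simp
  rw [this]
  have h5 : -(2 / (n : ℝ)) * Real.sqrt (bulk n x)
      = -(4 * bulk n x / n) / (2 * Real.sqrt (bulk n x)) := by
    rw [eq_div_iff (by positivity)]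
    linear_combination (-4 / (n : ℝ)) * hsq
  rw [h5, eq_sub_of_add_eq key]
  field_simp
  ring

theorem abs_one_div_mul_sqrt_sub_one_le {t : ℝ} (ht : 1 / 2 ≤ t) :
    |1 / (t * Real.sqrt t) - 1| ≤ 8 * |t - 1| := by
  have hu : 2 / 3 ≤ Real.sqrt t := Real.le_sqrt_of_sq_le (by norm_num; linarith)
  have hsq : t = Real.sqrt t ^ 2 := (Real.sq_sqrt (by linarith)).symm
  set u := Real.sqrt t
  rw [hsq]
  have hu0 : 0 < u := by linarith
  have e1 : 1 / (u ^ 2 * u) - 1 = -((u - 1) * ((1 + u + u ^ 2) / u ^ 3)) := by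
    field_simp; ring
  have e2 : u ^ 2 - 1 = (u - 1) * (1 + u) := by ring
  rw [e1, e2, abs_neg, abs_mul, abs_mul, mul_left_comm, abs_of_pos (by positivity : 0 < 1 + u),
    abs_of_pos (by positivity : 0 < (1 + u + u ^ 2) / u ^ 3)]
  refine mul_le_mul_of_nonneg_left ?_ (abs_nonneg _)
  rw [div_le_iff₀ (by positivity)]
  have h3 : 4 / 9 * u ≤ u ^ 3 := by nlinarith [sq_nonneg u]
  have h4 : 2 / 3 * u ^ 2 ≤ u ^ 3 := by nlinarith [sq_nonneg u]
  have h5 : 4 / 9 * u ^ 2 ≤ u ^ 4 := by nlinarith [sq_nonneg u]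
  nlinarith

/-- By the mean value theorem the increment is the derivative at some `ξ` in `(b, b+1)`, and `β`
changes by at most one over that interval. -/
theorem abs_profile_increment_le {n b : ℕ} (hb : 1 ≤ b) (hbn : b + 1 < n) :
    |(profile n (b + 1) - profile n b) * (2 * (bulk n b * Real.sqrt (bulk n b))) + 1|
      ≤ 8 / bulk n b := by
  have hn1 : 1 ≤ n := by omega
  have hb0 : (1 : ℝ) ≤ b := by exact_mod_cast hb
  have hbn0 : (b : ℝ) + 2 ≤ n := by exact_mod_cast hbn
  have hn0 : (0 : ℝ) < n := by linarith
  have hpos : ∀ x ∈ Set.Icc (b : ℝ) (b + 1), 0 < bulk n x := by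
    intro x hx
    rw [bulk_eq hn1]
    have := hx.1
    have := hx.2
    exact div_pos (mul_pos (by linarith) (by linarith)) hn0
  obtain ⟨ξ, hξ, hd⟩ := exists_hasDerivAt_eq_slope (profile n) _ (by linarith : (b : ℝ) < b + 1)
    (fun x hx => (hasDerivAt_profile hn1 (hpos x hx)).continuousAt.continuousWithinAt)
    (fun x hx => hasDerivAt_profile hn1 (hpos x ⟨hx.1.le, hx.2.le⟩))
  rw [add_sub_cancel_left, div_one] at hd
  rw [← hd]
  have hβ := bulk_pos hb (by omega : b < n)
  have hβξ := hpos ξ ⟨hξ.1.le, hξ.2.le⟩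
  set t := bulk n ξ / bulk n b with ht
  have hts : bulk n ξ = t * bulk n b := by rw [ht]; field_simp
  have ht0 : 0 < t := div_pos hβξ hβ
  have e : -(1 / (2 * (bulk n ξ * Real.sqrt (bulk n ξ))))
      * (2 * (bulk n b * Real.sqrt (bulk n b))) + 1 = -(1 / (t * Real.sqrt t) - 1) := by
    have h1 : 0 < Real.sqrt t := Real.sqrt_pos.mpr ht0
    have h2 : 0 < Real.sqrt (bulk n b) := Real.sqrt_pos.mpr hβ
    rw [hts, Real.sqrt_mul ht0.le]
    field_simp
    ring
  have hdiff : bulk n ξ - bulk n b = (ξ - b) * (n - ξ - b) / n := by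
    rw [bulk_eq hn1, bulk_eq hn1]; field_simp; ring
  have ht2 : |t - 1| ≤ 1 / bulk n b := by
    rw [ht, div_sub_one hβ.ne', abs_div, abs_of_pos hβ]
    gcongr
    rw [hdiff, abs_div, abs_of_pos hn0, div_le_one hn0, abs_mul]
    have h1 : |ξ - b| ≤ 1 := by rw [abs_le]; constructor <;> linarith [hξ.1, hξ.2]
    have h2 : |(n : ℝ) - ξ - b| ≤ n := by rw [abs_le]; constructor <;> linarith [hξ.1, hξ.2]
    calc |ξ - b| * |(n : ℝ) - ξ - b| ≤ 1 * n := by gcongr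
      _ = n := one_mul _
  -- Here `b + 1 < n` matters: it gives `n - ξ ≥ (n - b)/2`.
  have ht1 : 1 / 2 ≤ t := by
    rw [ht, le_div_iff₀ hβ, bulk_eq hn1, bulk_eq hn1, mul_div_assoc']
    refine div_le_div_of_nonneg_right ?_ hn0.le
    nlinarith [hξ.1, hξ.2]
  rw [e, abs_neg]
  calc _ ≤ 8 * |t - 1| := abs_one_div_mul_sqrt_sub_one_le ht1
    _ ≤ 8 * (1 / bulk n b) := by gcongr
    _ = _ := by ring

/-! ### The mean step and its increments -/

/-- The mean of step number `b` over weighted Motzkin paths of length `n`. -/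
noncomputable def meanStep (q : ℝ) (n b : ℕ) : ℝ :=
  stepMoment (q ^ 2) (b - 1) (n - b) 0 / pathWeight (q ^ 2) n 0

/-- The two shorter lengths add up to `n - 2`, so the exponential factors leave `(2q+1)^(-2)`, which
combines with `s = q²` into `σ²`. -/
theorem meanStep_succ_sub {q : ℝ} (hq : 0 < q) {n b : ℕ} (hb : 1 ≤ b) (hbn : b < n) :
    meanStep q n (b + 1) - meanStep q n b = -(2 * (q / (2 * q + 1)) ^ 2 *
      (scaledWeight q (b - 1) * scaledWeight q (n - b - 1) / scaledWeight q n)) := by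
  obtain ⟨i, rfl⟩ : ∃ i, b = i + 1 := ⟨b - 1, by omega⟩
  obtain ⟨j, rfl⟩ : ∃ j, n = i + j + 2 := ⟨n - i - 2, by omega⟩
  have h1 : i + 1 + 1 - 1 = i + 1 := by omega
  have h2 : i + j + 2 - (i + 1 + 1) = j := by omega
  have h3 : i + 1 - 1 = i := by omega
  have h4 : i + j + 2 - (i + 1) = j + 1 := by omega
  have h5 : j + 1 - 1 = j := by omega
  rw [meanStep, meanStep, h1, h2, h3, h4, h5, stepMoment_succ]
  have hw := zero_lt_one.trans_le (one_le_pathWeight_zero (sq_nonneg q) (i + j + 2))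
  have hl : 0 < 2 * q + 1 := by linarith
  simp only [scaledWeight]
  field_simp
  ring

theorem meanStep_reflect {q : ℝ} {n b : ℕ} (hb : 1 ≤ b) (hbn : b ≤ n) :
    meanStep q n (n + 1 - b) = -meanStep q n b := by
  rw [meanStep, meanStep, stepMoment_antisymm, show n - (n + 1 - b) = b - 1 by omega,
    show n + 1 - b - 1 = n - b by omega, neg_div]

/-- The amplitude of the mean step. -/
noncomputable def stepAmplitude (q : ℝ) : ℝ := 2 * Real.sqrt (q / (2 * q + 1) / Real.pi)

theorem stepAmplitude_pos {q : ℝ} (hq : 0 < q) : 0 < stepAmplitude q := by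
  have := Real.pi_pos
  rw [stepAmplitude]; positivity

/-- Determines the amplitude: the leading increment of the mean step must equal `stepAmplitude`
times the slope of the profile. -/
theorem two_mul_sq_mul_growthConst {q : ℝ} (hq : 0 < q) :
    2 * (q / (2 * q + 1)) ^ 2 * growthConst q = stepAmplitude q / 2 := by
  have hσ : 0 < q / (2 * q + 1) := by positivity
  rw [growthConst, stepAmplitude]
  set σ := q / (2 * q + 1)
  have h1 : 0 < Real.sqrt σ := Real.sqrt_pos.mpr hσ
  have h2 : 0 < Real.sqrt Real.pi := Real.sqrt_pos.mpr Real.pi_pos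
  have h3 : Real.sqrt σ * Real.sqrt σ = σ := Real.mul_self_sqrt hσ.le
  rw [Real.sqrt_div hσ.le]
  field_simp
  linear_combination (-1 : ℝ) * h3

theorem exists_abs_meanStep_increment_le {q : ℝ} (hq : 1 ≤ q) :
    ∃ C : ℝ, 0 < C ∧ ∀ n b : ℕ, 1 ≤ b → b < n →
      |(meanStep q n (b + 1) - meanStep q n b) * (bulk n b * Real.sqrt (bulk n b))
        + stepAmplitude q / 2| ≤ C / bulk n b := by
  have hq0 : 0 < q := by linarith
  obtain ⟨C, hC, h⟩ := exists_abs_weightRatio_sub_le hq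
  refine ⟨2 * (q / (2 * q + 1)) ^ 2 * C, by positivity, fun n b hb hbn => ?_⟩
  rw [meanStep_succ_sub hq0 hb hbn, ← two_mul_sq_mul_growthConst hq0]
  have e : ∀ a x B c : ℝ, -(a * x) * B + a * c = -(a * (x * B - c)) := by intros; ring
  rw [e, abs_neg, abs_mul,
    abs_of_nonneg (by positivity : 0 ≤ 2 * (q / (2 * q + 1)) ^ 2), mul_div_assoc _ C]
  exact mul_le_mul_of_nonneg_left (h n b hb hbn) (by positivity)

/-- The deviation of the mean step from its asymptotic profile. -/
noncomputable def stepError (q : ℝ) (n b : ℕ) : ℝ :=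
  meanStep q n b - stepAmplitude q * profile n b

/-- The `β^(-3/2)` terms cancel and leave `O(β^(-5/2))`, weakened to `β^(-2)` because `1/√β ≤ 2`;
this still sums to `O(1/β)`. -/
theorem exists_abs_stepError_increment_le {q : ℝ} (hq : 1 ≤ q) :
    ∃ C : ℝ, 0 < C ∧ ∀ n b : ℕ, 1 ≤ b → b + 1 < n →
      |stepError q n (b + 1) - stepError q n b| ≤ C * (1 / bulk n b) ^ 2 := by
  have hq0 : 0 < q := by linarith
  have hκ := stepAmplitude_pos hq0
  obtain ⟨C, hC, h⟩ := exists_abs_meanStep_increment_le hq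
  set κ := stepAmplitude q
  refine ⟨2 * (C + 4 * κ), by positivity, fun n b hb hbn => ?_⟩
  have hβ := bulk_pos hb (by omega : b < n)
  have hs := Real.sqrt_pos.mpr hβ
  have h1 := h n b hb (by omega)
  have h2 := abs_profile_increment_le hb hbn
  have h3 := one_div_sqrt_bulk_le_two hb (by omega : b < n)
  set β := bulk n b
  have e : (stepError q n (b + 1) - stepError q n b) * (β * Real.sqrt β)
      = ((meanStep q n (b + 1) - meanStep q n b) * (β * Real.sqrt β) + κ / 2)
        - κ / 2 * ((profile n (b + 1) - profile n b) * (2 * (β * Real.sqrt β)) + 1) := by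
    simp only [stepError]; push_cast; ring
  have h4 : |stepError q n (b + 1) - stepError q n b| * (β * Real.sqrt β)
      ≤ (C + 4 * κ) / β := by
    rw [← abs_of_pos (by positivity : 0 < β * Real.sqrt β), ← abs_mul, e]
    refine (abs_sub _ _).trans ?_
    rw [abs_mul (κ / 2), abs_of_pos (by positivity : 0 < κ / 2)]
    calc _ ≤ C / β + κ / 2 * (8 / β) := by gcongr
      _ = _ := by ring
  rw [← le_div_iff₀ (by positivity)] at h4
  calc _ ≤ (C + 4 * κ) / β / (β * Real.sqrt β) := h4
    _ = (C + 4 * κ) * (1 / β) ^ 2 * (1 / Real.sqrt β) := by field_simp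
    _ ≤ (C + 4 * κ) * (1 / β) ^ 2 * 2 := by gcongr
    _ = _ := by ring

theorem one_div_bulk_half_le {n : ℕ} (hn : 2 ≤ n) : 1 / bulk n (n / 2 : ℕ) ≤ 6 / n := by
  have h1 : 1 ≤ n / 2 := by omega
  have h2 : n / 2 < n := by omega
  have hn0 : (0 : ℝ) < n := by positivity
  rw [one_div_bulk h1 h2]
  have h3 : (n : ℝ) ≤ 3 * (n / 2 : ℕ) := by exact_mod_cast (by omega : n ≤ 3 * (n / 2))
  have h4 : (n : ℝ) ≤ 2 * (n - n / 2 : ℕ) := by exact_mod_cast (by omega : n ≤ 2 * (n - n / 2))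
  have h5 : 1 / ((n / 2 : ℕ) : ℝ) ≤ 3 / n := by
    rw [div_le_div_iff₀ (by linarith) hn0]; linarith
  have h6 : 1 / ((n - n / 2 : ℕ) : ℝ) ≤ 2 / n := by
    rw [div_le_div_iff₀ (by linarith) hn0]; linarith
  have h7 : (6 : ℝ) / n = 3 / n + 2 / n + 1 / n := by ring
  have h8 : 0 < 1 / (n : ℝ) := by positivity
  linarith

theorem exists_abs_stepError_half_le {q : ℝ} (hq : 1 ≤ q) :
    ∃ E : ℝ, 0 < E ∧ ∀ n : ℕ, 2 ≤ n → |stepError q n (n / 2)| ≤ E / n := by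
  have hq0 : 0 < q := by linarith
  have hκ := stepAmplitude_pos hq0
  obtain ⟨C, hC, h⟩ := exists_abs_meanStep_increment_le hq
  set κ := stepAmplitude q with hκdef
  refine ⟨(2 * C + κ / 2) * 12 + 2 * κ, by positivity, fun n hn => ?_⟩
  have h1 : 1 ≤ n / 2 := by omega
  have h2 : n / 2 < n := by omega
  have hn0 : (0 : ℝ) < n := by positivity
  set m := n / 2 with hm
  have hβ := bulk_pos h1 h2
  have hs := Real.sqrt_pos.mpr hβ
  have hβ2 := one_div_bulk_le_two h1 h2
  have hβs := one_div_sqrt_bulk_le_two h1 h2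
  have hβn := one_div_bulk_half_le hn
  rw [← hm] at hβn
  have hinc := h n m h1 h2
  have hprof : |profile n m| ≤ 2 / n := by
    rw [profile, div_eq_mul_one_div, abs_mul,
      abs_of_pos (by positivity : 0 < 1 / Real.sqrt (bulk n m))]
    have h3 : |1 - 2 * (m : ℝ) / n| ≤ 1 / n := by
      rw [← div_self hn0.ne', div_sub_div_same, abs_div, abs_of_pos hn0]
      have h4 : 2 * (m : ℝ) ≤ n := by exact_mod_cast (by omega : 2 * m ≤ n)
      have h5 : (n : ℝ) ≤ 2 * m + 1 := by exact_mod_cast (by omega : n ≤ 2 * m + 1)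
      rw [div_self hn0.ne']
      gcongr
      rw [abs_le]; constructor <;> linarith
    calc _ ≤ 1 / (n : ℝ) * 2 := by gcongr
      _ = _ := by ring
  set β := bulk n m
  -- For even `n`, sites `m` and `m + 1` are mirror images and have opposite means; for odd `n`,
  -- site `m + 1` is its own mirror image and has mean zero.
  have hmean : |meanStep q n m| ≤ |meanStep q n (m + 1) - meanStep q n m| := by
    rcases Nat.even_or_odd' n with ⟨k, hk | hk⟩
    · have := meanStep_reflect (q := q) h1 h2.le
      rw [show n + 1 - m = m + 1 by omega] at this
      rw [this, show -meanStep q n m - meanStep q n m = -(2 * meanStep q n m) by ring, abs_neg,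
        abs_mul]
      have := abs_nonneg (meanStep q n m)
      norm_num
      linarith
    · have := meanStep_reflect (q := q) (b := m + 1) (n := n) (by omega) (by omega)
      rw [show n + 1 - (m + 1) = m + 1 by omega] at this
      have h0 : meanStep q n (m + 1) = 0 := by linarith
      rw [h0, zero_sub, abs_neg]
  have hd : |meanStep q n (m + 1) - meanStep q n m| * (β * Real.sqrt β) ≤ 2 * C + κ / 2 := by
    rw [← abs_of_pos (by positivity : 0 < β * Real.sqrt β), ← abs_mul]
    have e : (meanStep q n (m + 1) - meanStep q n m) * (β * Real.sqrt β)
        = ((meanStep q n (m + 1) - meanStep q n m) * (β * Real.sqrt β) + κ / 2) - κ / 2 := by ring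
    rw [e]
    refine (abs_sub _ _).trans ?_
    rw [abs_of_pos (by positivity : 0 < κ / 2)]
    have : C / β ≤ 2 * C := by
      rw [div_eq_mul_one_div, mul_comm 2 C]; gcongr
    linarith
  rw [← le_div_iff₀ (by positivity)] at hd
  have hd2 : (2 * C + κ / 2) / (β * Real.sqrt β) ≤ (2 * C + κ / 2) * 12 / n := by
    calc _ = (2 * C + κ / 2) * ((1 / β) * (1 / Real.sqrt β)) := by field_simp
      _ ≤ (2 * C + κ / 2) * ((6 / n) * 2) := by gcongr
      _ = _ := by ring
  rw [stepError, ← hκdef]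
  refine (abs_sub _ _).trans ?_
  rw [abs_mul, abs_of_pos hκ]
  calc _ ≤ (2 * C + κ / 2) * 12 / n + κ * (2 / n) :=
        add_le_add (hmean.trans (hd.trans hd2)) (mul_le_mul_of_nonneg_left hprof hκ.le)
    _ = _ := by ring

/-- Summation of increments of size `β⁻²`, starting from the middle of the chain. -/
theorem abs_le_of_increment_le {e : ℕ → ℝ} {C E : ℝ} {n : ℕ} (hC : 0 ≤ C)
    (hinc : ∀ b, 1 ≤ b → b + 1 < n → |e (b + 1) - e b| ≤ C * (1 / bulk n b) ^ 2)
    (hmid : |e (n / 2)| ≤ E) {b : ℕ} (hb : 1 ≤ b) (hbn : b < n) :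
    |e b| ≤ E + 16 * C / bulk n b := by
  have hβ := one_div_bulk hb hbn
  have p1 : 0 ≤ 1 / (b : ℝ) := by positivity
  have p2 : 0 ≤ 1 / ((n - b : ℕ) : ℝ) := by positivity
  rw [div_eq_mul_one_div (16 * C), hβ]
  rcases le_total b (n / 2) with hle | hle
  -- In the left half `1/(n-k) ≤ 1/k`, so the increments are at most `4C/k² ≤ 8C(1/k - 1/(k+1))`,
  -- which telescopes.
  · suffices H : |e b| ≤ E + 8 * C * (1 / b) by nlinarith
    clear hβ p1 p2
    induction hle using Nat.decreasingInduction with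
    | self =>
      have : 0 ≤ 8 * C * (1 / ((n / 2 : ℕ) : ℝ)) := by positivity
      linarith
    | of_succ k hk ih =>
      have hk1 : 1 ≤ k := hb
      have ih := ih (by omega) (by omega)
      have h1 := hinc k hk1 (by omega)
      rw [one_div_bulk hk1 (by omega)] at h1
      have hk0 : (1 : ℝ) ≤ k := by exact_mod_cast hk1
      have h2 : 1 / ((n - k : ℕ) : ℝ) ≤ 1 / k := by
        have : (k : ℝ) ≤ (n - k : ℕ) := by exact_mod_cast (by omega : k ≤ n - k)
        gcongr
      have p2 : 0 ≤ 1 / ((n - k : ℕ) : ℝ) := by positivity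
      have h3 : (1 / (k : ℝ) + 1 / ((n - k : ℕ) : ℝ)) ^ 2 ≤ 8 * (1 / k - 1 / ((k + 1 : ℕ) : ℝ)) := by
        calc _ ≤ (1 / (k : ℝ) + 1 / k) ^ 2 := by gcongr
          _ = 4 / ((k : ℝ) * k) := by field_simp; norm_num
          _ ≤ 8 / ((k : ℝ) * (k + 1)) := by
            rw [div_le_div_iff₀ (by positivity) (by positivity)]; nlinarith
          _ = _ := by push_cast; field_simp; ring
      have h4 := h1.trans (mul_le_mul_of_nonneg_left h3 hC)
      have h5 := abs_sub_abs_le_abs_sub (e k) (e (k + 1))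
      rw [abs_sub_comm] at h5
      linarith
  -- Rounding in `n / 2` leaves only `1/k ≤ 2/(n-k)`; hence `9` replaces `4` in the increments, and
  -- the telescoping constant is `16`.
  · suffices H : |e b| ≤ E + 16 * C * (1 / (n - b : ℕ)) by nlinarith
    clear hβ p1 p2
    induction b, hle using Nat.le_induction with
    | base =>
      have : 0 ≤ 16 * C * (1 / ((n - n / 2 : ℕ) : ℝ)) := by positivity
      linarith
    | succ k hk ih =>
      have hk1 : 1 ≤ k := by omega
      have ih := ih hk1 (by omega)
      have h1 := hinc k hk1 hbn
      rw [one_div_bulk hk1 (by omega)] at h1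
      obtain ⟨j, hj⟩ : ∃ j, n - (k + 1) = j := ⟨_, rfl⟩
      have hj' : n - k = j + 1 := by omega
      have hj1 : 1 ≤ j := by omega
      rw [hj'] at h1 ih
      rw [hj]
      have hj0 : (1 : ℝ) ≤ j := by exact_mod_cast hj1
      have hk0 : (1 : ℝ) ≤ k := by exact_mod_cast hk1
      have h2 : 1 / (k : ℝ) ≤ 2 / ((j + 1 : ℕ) : ℝ) := by
        have : ((j + 1 : ℕ) : ℝ) ≤ 2 * k := by exact_mod_cast (by omega : j + 1 ≤ 2 * k)
        rw [div_le_div_iff₀ (by positivity) (by positivity)]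
        linarith
      have h3 : (1 / (k : ℝ) + 1 / ((j + 1 : ℕ) : ℝ)) ^ 2
          ≤ 16 * (1 / (j : ℝ) - 1 / ((j + 1 : ℕ) : ℝ)) := by
        calc _ ≤ (2 / ((j + 1 : ℕ) : ℝ) + 1 / ((j + 1 : ℕ) : ℝ)) ^ 2 := by gcongr
          _ = 9 / (((j : ℝ) + 1) * (j + 1)) := by push_cast; field_simp; norm_num
          _ ≤ 16 / ((j : ℝ) * (j + 1)) := by
            rw [div_le_div_iff₀ (by positivity) (by positivity)]; nlinarith
          _ = _ := by push_cast; field_simp; ring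
      have h4 := h1.trans (mul_le_mul_of_nonneg_left h3 hC)
      have h5 := abs_sub_abs_le_abs_sub (e (k + 1)) (e k)
      linarith

theorem exists_abs_stepError_le {q : ℝ} (hq : 1 ≤ q) :
    ∃ C : ℝ, 0 < C ∧ ∀ n b : ℕ, 1 ≤ b → b < n → |stepError q n b| ≤ C / bulk n b := by
  obtain ⟨C, hC, h1⟩ := exists_abs_stepError_increment_le hq
  obtain ⟨E, hE, h2⟩ := exists_abs_stepError_half_le hq
  refine ⟨E + 16 * C, by positivity, fun n b hb hbn => ?_⟩
  have h := abs_le_of_increment_le hC.le (h1 n) (h2 n (by omega)) hb hbn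
  have hb0 : (0 : ℝ) < b := by positivity
  have hbn' : (b : ℝ) ≤ n := by exact_mod_cast hbn.le
  have h3 : E / n ≤ E / bulk n b := by
    rw [div_eq_mul_one_div, div_eq_mul_one_div E (bulk n b)]
    have h4 : 1 / (n : ℝ) ≤ 1 / b := by gcongr
    have h5 : 0 ≤ 1 / ((n - b : ℕ) : ℝ) := by positivity
    rw [one_div_bulk hb hbn]
    gcongr
    linarith
  rw [add_div]
  linarith

/-! ### From the mean step to the three claims on the magnetization. -/

theorem exists_norm_localMagnetization_sub_le {s : ℕ} (hs : 1 ≤ s) :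
    ∃ C : ℝ, 0 < C ∧ ∀ (n b : ℕ) (hi : b - 1 < n), 1 ≤ b → b < n →
      ‖localMagnetization s n ⟨b - 1, hi⟩ - ((magnetizationProfile s n b : ℝ) : ℂ)‖
        ≤ C / bulk n b := by
  have hq : 1 ≤ Real.sqrt s := Real.one_le_sqrt.mpr (by exact_mod_cast hs)
  obtain ⟨C, hC, h⟩ := exists_abs_stepError_le hq
  refine ⟨((s : ℝ) + 1) / 2 * C, by positivity, fun n b hi hb hbn => ?_⟩
  rw [localMagnetization_eq_stepMoment s n (b - 1) (n - b) (by omega), ← Complex.ofReal_sub,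
    Complex.norm_real, Real.norm_eq_abs]
  have e : ((s : ℝ) + 1) / 2 * (stepMoment s (b - 1) (n - b) 0 / pathWeight s n 0)
      - magnetizationProfile s n b = ((s : ℝ) + 1) / 2 * stepError (Real.sqrt s) n b := by
    rw [stepError, meanStep, Real.sq_sqrt (Nat.cast_nonneg s), stepAmplitude, profile, bulk,
      magnetizationProfile, motzkinSigma]
    ring
  rw [e, abs_mul, abs_of_pos (by positivity), mul_div_assoc]
  exact mul_le_mul_of_nonneg_left (h n b hb hbn) (by positivity)

theorem theorem4 (s : ℕ) (hs : 1 ≤ s) :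
    (∃ C : ℝ, 0 < C ∧ ∀ (n b : ℕ) (hb : 1 ≤ b) (hbn : b < n),
      ‖localMagnetization s n ⟨b - 1, by omega⟩ - ((magnetizationProfile s n b : ℝ) : ℂ)‖
        ≤ C / ((b : ℝ) * (1 - (b : ℝ) / n))) ∧
    (∀ δ : ℝ, 0 < δ → ∃ C : ℝ, 0 < C ∧ ∀ (n b : ℕ) (hb : 1 ≤ b) (hbn : b < n),
      δ * n ≤ b → (b : ℝ) ≤ (1 - δ) * n →
      ‖localMagnetization s n ⟨b - 1, by omega⟩ - ((magnetizationProfile s n b : ℝ) : ℂ)‖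
        ≤ C / n) ∧
    (∀ (n b : ℕ → ℕ) (hb : ∀ k, 1 ≤ b k ∧ b k < n k),
      Tendsto b atTop atTop → Tendsto (fun k => n k - b k) atTop atTop →
      (∃ ε : ℝ, 0 < ε ∧ ∀ k, ε ≤ |1 - 2 * (b k : ℝ) / n k|) →
      Asymptotics.IsEquivalent atTop
        (fun k => localMagnetization s (n k) ⟨b k - 1, by have := hb k; omega⟩)
        (fun k => ((magnetizationProfile s (n k) (b k) : ℝ) : ℂ))) := by
  obtain ⟨C, hC, h⟩ := exists_norm_localMagnetization_sub_le hs
  refine ⟨⟨C, hC, fun n b hb hbn => h n b _ hb hbn⟩,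
    -- In the bulk `b ≥ δn` and `1 - b/n ≥ δ`, so `β ≥ δ² n`.
    fun δ hδ => ⟨C / (δ * δ), by positivity, fun n b hb hbn h1 h2 => ?_⟩, ?_⟩
  · refine (h n b _ hb hbn).trans ?_
    have hn0 : (0 : ℝ) < n := by
      have : 0 < n := by omega
      positivity
    rw [div_div]
    gcongr
    rw [bulk]
    have h3 : δ ≤ 1 - (b : ℝ) / n := by
      rw [le_sub_comm, div_le_iff₀ hn0]; exact h2
    calc δ * δ * n = (δ * n) * δ := by ring
      _ ≤ b * (1 - (b : ℝ) / n) := by gcongr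
  · rintro n b hb htb htn ⟨ε, hε, hεk⟩
    set A := ((s : ℝ) + 1) * Real.sqrt (motzkinSigma s / Real.pi) with hA
    have hA0 : 0 < A := by
      have hs0 : (0 : ℝ) < s := by exact_mod_cast hs
      have := Real.pi_pos
      rw [hA, motzkinSigma]; positivity
    -- The profile is at least of order `1/√β` while the error is `O(1/β)`, so the relative error is
    -- `O(1/√β)`, which tends to zero.
    have hprof : ∀ k, A * ε / Real.sqrt (bulk (n k) (b k))
        ≤ ‖((magnetizationProfile s (n k) (b k) : ℝ) : ℂ)‖ := by
      intro k
      have hp := Real.sqrt_pos.mpr (bulk_pos (hb k).1 (hb k).2)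
      rw [Complex.norm_real, Real.norm_eq_abs, magnetizationProfile, ← hA, abs_mul, abs_div,
        abs_of_pos hA0, ← bulk, abs_of_pos hp, mul_div_assoc]
      have := hεk k
      gcongr
    have hβ : Tendsto (fun k => Real.sqrt (1 / bulk (n k) (b k))) atTop (nhds 0) := by
      have h1 : Tendsto (fun k => 1 / ((b k : ℕ) : ℝ)) atTop (nhds 0) :=
        tendsto_one_div_atTop_nhds_zero_nat.comp htb
      have h2 : Tendsto (fun k => 1 / ((n k - b k : ℕ) : ℝ)) atTop (nhds 0) :=
        tendsto_one_div_atTop_nhds_zero_nat.comp htn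
      have h3 := (h1.add h2).sqrt
      rw [add_zero, Real.sqrt_zero] at h3
      refine h3.congr fun k => ?_
      rw [one_div_bulk (hb k).1 (hb k).2]
    rw [Asymptotics.IsEquivalent, Asymptotics.isLittleO_iff]
    intro c hc
    have hsmall : 0 < c * (A * ε) / C := by positivity
    filter_upwards [hβ.eventually_lt_const hsmall] with k hk
    have hpos := bulk_pos (hb k).1 (hb k).2
    have hp := Real.sqrt_pos.mpr hpos
    rw [Real.sqrt_div zero_le_one, Real.sqrt_one, lt_div_iff₀ hC] at hk
    refine (h (n k) (b k) _ (hb k).1 (hb k).2).trans ?_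
    refine le_trans ?_ (mul_le_mul_of_nonneg_left (hprof k) hc.le)
    have e : C / bulk (n k) (b k) = (1 / Real.sqrt (bulk (n k) (b k)) * C)
        / Real.sqrt (bulk (n k) (b k)) := by
      rw [div_mul_eq_mul_div, div_div, Real.mul_self_sqrt hpos.le, one_mul]
    rw [e, ← mul_div_assoc]
    gcongr
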